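/- All graphs are finite. A bipartite graph $F$ with fixed bipartition $V_1(F)\cup V_2(F)$ is described by the sets $F^A=\{v\in V_2(F):\Gamma_F(v)=A\}$, $A\subseteq V_1(F)$. A weight $\mathbf f$ on a finite set $V(\mathbf f)$ is a family $(f_A)_{A\subseteq V(\mathbf f)}$ of non-negative reals; its size is $e(\mathbf f)=\sum_A f_A|A|$, and $d(x)=\sum_{A\ni x}f_A$ is the degree of $x\in V(\mathbf f)$. A sequence $(F_n)_{n\in\mathbb N}$ of bipartite graphs is a dilatation of $\mathbf f$ if, for every $n$, $V_1(F_n)=V(\mathbf f)$ and, for every $A\subseteq V(\mathbf f)$, $F_n^A=\emptyset$ if and only if $f_A=0$, and if moreover $|F_n^A|=f_An+o(n)$ as $n\to\infty$, for every $A\subseteq V(\mathbf f)$. For a graph $F$ and a weight $\mathbf f$, write $F\subset\mathbf f$ if for some bipartition $V(F)=V_1\cup V_2$ there is an injection $h:V_1\to V(\mathbf f)$ such that for every $A\subseteq V_1$ which lies in the neighbourhood of some vertex of $V_2$ there is $B\supseteq h(A)$ with $f_B>0$. For weights $\mathbf f,\mathbf g$ (after adding, if necessary, new elements to $V(\mathbf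 g)$, with $\mathbf g$ zero on all new sets, so that $|V(\mathbf f)|\le|V(\mathbf g)|$) write $\mathbf f\subset\mathbf g$ if there are an injection $h:V(\mathbf f)\to V(\mathbf g)$ and numbers $w_{AB}\ge0$ ($A\subseteq V(\mathbf f)$, $B\subseteq V(\mathbf g)$) with $w_{AB}=0$ unless $h(A)\subseteq B$, $\sum_{B\supseteq h(A)}w_{AB}\ge f_A$ for all $A$, and $\sum_{A:\,h(A)\subseteq B}w_{AB}\le g_B$ for all $B$. An $r$-colouring $\mathbf c$ of a weight $\mathbf g$ is a family of non-negative reals $c_{A_1,\dots,A_r}$, indexed by the $r$-tuples of pairwise disjoint subsets of $V(\mathbf g)$, with $\sum_{A_1\cup\dots\cup A_r=A}c_{A_1,\dots,A_r}>g_A$ for all $A\subseteq V(\mathbf g)$; its $i$-th colour subweight is the weight $\mathbf c_i$ on $V(\mathbf g)$ with $c_{i,A}=\sum_{A_i=A}c_{A_1,\dots,A_r}$. Let $r\ge q\ge1$, let $\mathbf f_1,\dots,\mathbf f_q$ be weights in which every $x\in V(\mathbf f_i)$ has $d(x)>0$, and let $F_{q+1},\dots,F_r$ be bipartite graphs without isolated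 vertices. Put $\mathbf F=(\mathbf f_1,\dots,\mathbf f_q,F_{q+1},\dots,F_r)$. A weight $\mathbf g$ arrows $\mathbf F$, written $\mathbf g\to\mathbf F$, if for every $r$-colouring $\mathbf c$ of $\mathbf g$ we have $\mathbf f_i\subset\mathbf c_i$ for some $i\le q$ or $F_i\subset\mathbf c_i$ for some $i>q$. Let $\hat r(\mathbf F)=\inf\{e(\mathbf g):\mathbf g\to\mathbf F\}$. The size Ramsey number $\hat r(G_1,\dots,G_r)$ of graphs is the least number of edges of a graph $G$ such that every $r$-colouring of $E(G)$ has, for some $i$, a copy of $G_i$ all of whose edges have colour $i$. **Theorem.** Some weight arrows $\mathbf F$, so $\hat r(\mathbf F)<\infty$, and there is a constant $M=M(\mathbf F)$ such that the following holds. For all dilatations $(F_{i,n})_{n\in\mathbb N}$ of $\mathbf f_i$, $i=1,\dots,q$, the number $\hat r(F_{1,n},\dots,F_{q,n},F_{q+1},\dots,F_r)$ is well defined for every $n$, and for all sufficiently large $n$ $$\hat r(\mathbf F)\,n-M(1+f_0)\le\hat r(F_{1,n},\dots,F_{q,n},F_{q+1},\dots,F_r)\le\hat r(\mathbf F)\,n+M(1+f_0),$$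 where $f_0=f_0(n)=\max\{\,\bigl||F_{i,n}^A|-f_{i,A}n\bigr| : 1\le i\le q,\ A\subseteq V(\mathbf f_i)\}$. In particular, $\lim_{n\to\infty}\hat r(F_{1,n},\dots,F_{q,n},F_{q+1},\dots,F_r)/n$ exists and equals $\hat r(\mathbf F)$. -/

import Mathlib

open Filter Topology Asymptotics

noncomputable section

namespace SizeRamsey

universe u v w

/- Size Ramsey numbers of tuples of finite graphs. -/

/-- A finite graph. -/
structure FinGraph : Type (u + 1) where
  V : Type u
  [fintypeV : Fintype V]
  graph : SimpleGraph V

attribute [instance] FinGraph.fintypeV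

/-- No vertex of `H` has degree zero. -/
def FinGraph.NoIsolated (H : FinGraph.{u}) : Prop :=
  ∀ x : H.V, ∃ y : H.V, H.graph.Adj x y

/-- `G → (F i)_i`: every colouring of the edges of `G` with the colours `κ` has, for some `i`, a
copy of `F i` of colour `i`. -/
def GraphArrows {V : Type v} (G : SimpleGraph V) {κ : Type w} (F : κ → FinGraph.{u}) : Prop :=
  ∀ c : G.EdgeLabeling κ, ∃ i : κ, (F i).graph.IsContained (c.labelGraph i)

/-- The size Ramsey number: the least number of edges of a finite graph that arrows the tuple.
(Up to isomorphism, every finite graph has vertex set `Fin N`.) -/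
def sizeRamsey {κ : Type w} (F : κ → FinGraph.{u}) : ℕ :=
  sInf {m : ℕ | ∃ (N : ℕ) (G : SimpleGraph (Fin N)), GraphArrows G F ∧ G.edgeSet.ncard = m}

/- Bipartite graphs, weights and dilatations. -/

/-- A finite bipartite graph with first part `V` and second part `V₂`. -/
structure BipGraph (V : Type u) : Type (u + 1) where
  V₂ : Type u
  [fintypeV₂ : Fintype V₂]
  Adj : V → V₂ → Prop

attribute [instance] BipGraph.fintypeV₂

/-- The underlying graph, with vertex set the disjoint union of the two parts. -/
def BipGraph.toFinGraph {V : Type u} [Fintype V] (F : BipGraph V) : FinGraph.{u} where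
  V := V ⊕ F.V₂
  graph :=
    { Adj := fun a b =>
        (∃ x y, a = Sum.inl x ∧ b = Sum.inr y ∧ F.Adj x y) ∨
        (∃ x y, a = Sum.inr y ∧ b = Sum.inl x ∧ F.Adj x y)
      symm := by
        constructor
        rintro a b (⟨x, y, h₁, h₂, h⟩ | ⟨x, y, h₁, h₂, h⟩)
        · exact Or.inr ⟨x, y, h₂, h₁, h⟩
        · exact Or.inl ⟨x, y, h₂, h₁, h⟩
      loopless := by
        constructor
        rintro a (⟨x, y, h₁, h₂, -⟩ | ⟨x, y, h₁, h₂, -⟩) <;>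
          · rw [h₁] at h₂
            cases h₂ }

open Classical in
/-- `F^A`, the set of vertices of the second part whose neighbourhood is exactly `A`. -/
def BipGraph.fiber {V : Type u} (F : BipGraph V) (A : Finset V) : Finset F.V₂ :=
  Finset.univ.filter fun y => ∀ x : V, x ∈ A ↔ F.Adj x y

/-- A weight on `V`: non-negative reals indexed by the subsets of `V`. -/
structure Weight (V : Type u) where
  val : Finset V → ℝ
  nonneg : ∀ A, 0 ≤ val A

namespace Weight

variable {V : Type u} [Fintype V]

/-- The size `e(f) = ∑_A f_A |A|`. -/
def size (f : Weight V) : ℝ := ∑ A : Finset V, f.val A * (A.card : ℝ)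

open Classical in
/-- The degree `d(x) = ∑_{A ∋ x} f_A`. -/
def degree (f : Weight V) (x : V) : ℝ := ∑ A : Finset V with x ∈ A, f.val A

/-- No element of `V` has degree zero. -/
def NoIsolated (f : Weight V) : Prop := ∀ x : V, f.degree x ≠ 0

end Weight

/-- `F` agrees with `f`. -/
def BipGraph.Agrees {V : Type u} (F : BipGraph V) (f : Weight V) : Prop :=
  ∀ A : Finset V, F.fiber A = ∅ ↔ f.val A = 0

/-- The sequence `F` is a dilatation of `f`: each `F n` agrees with `f`, and
`|F_n^A| = f_A n + o(n)` for all `A`. -/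
def IsDilatation {V : Type u} (f : Weight V) (F : ℕ → BipGraph V) : Prop :=
  (∀ n, (F n).Agrees f) ∧
    ∀ A : Finset V,
      (fun n : ℕ => (((F n).fiber A).card : ℝ) - f.val A * n) =o[atTop] fun n : ℕ => (n : ℝ)

/- Containment in a weight. -/

/-- `F ⊂ f` for a graph `F` and a weight `f`: for some bipartition of `V(F)` into `P` and its
complement there is an injection `h : P → V(f)` such that each `A ⊆ P` dominated by a vertex of
the other part has `h(A) ⊆ B` for some `B` with `f_B > 0`. -/
def FinGraph.InWeight (F : FinGraph.{v}) {V : Type u} (f : Weight V) : Prop :=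
  ∃ P : Set F.V,
    (∀ x y, F.graph.Adj x y → (x ∈ P ↔ y ∉ P)) ∧
    ∃ h : P ↪ V, ∀ A : Finset P,
      (∃ y : F.V, y ∉ P ∧ ∀ x ∈ A, F.graph.Adj y x) → ∃ B : Finset V, A.map h ⊆ B ∧ 0 < f.val B

/-- The weight on `V ⊔ U` which extends `g` by zero on all sets that meet `U`. -/
def Weight.pad {V : Type u} (g : Weight V) (U : Type w) : Weight (V ⊕ U) where
  val B := if B.toRight.card = 0 then g.val B.toLeft else 0
  nonneg B := by
    split_ifs
    · exact g.nonneg _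
    · exact le_rfl

open Classical in
/-- `h` and `w` map the weight `f` into the weight `g`. -/
structure Weight.Embeds {V : Type u} {U : Type v} [Fintype V] [Fintype U]
    (f : Weight V) (g : Weight U) (h : V ↪ U) (w : Finset V → Finset U → ℝ) : Prop where
  nonneg : ∀ A B, 0 ≤ w A B
  eq_zero : ∀ A B, ¬ A.map h ⊆ B → w A B = 0
  le_sum : ∀ A, f.val A ≤ ∑ B : Finset U with A.map h ⊆ B, w A B
  sum_le : ∀ B, ∑ A : Finset V with A.map h ⊆ B, w A B ≤ g.val B

/-- `f ⊂ g` for weights. If `V(g)` has fewer elements than `V(f)`, it is first enlarged to the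
same number of elements, `g` being zero on all new sets (the subtraction truncates at `0`). -/
def Weight.InWeight {V : Type u} {U : Type v} [Fintype V] [Fintype U]
    (f : Weight V) (g : Weight U) : Prop :=
  ∃ (h : V ↪ U ⊕ Fin (Fintype.card V - Fintype.card U))
    (w : Finset V → Finset (U ⊕ Fin (Fintype.card V - Fintype.card U)) → ℝ),
    f.Embeds (g.pad (Fin (Fintype.card V - Fintype.card U))) h w

/- Colourings of weights. -/

/-- Tuples, indexed by the colours, of pairwise disjoint subsets of `V`. -/
abbrev DisjointTuple (κ : Type w) (V : Type u) : Type (max u w) :=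
  {A : κ → Finset V // ∀ i j, i ≠ j → Disjoint (A i) (A j)}

open Classical in
/-- A colouring of the weight `g` with the colours `κ`. -/
structure Colouring (κ : Type w) [Fintype κ] {V : Type u} [Fintype V] (g : Weight V) where
  val : DisjointTuple κ V → ℝ
  nonneg : ∀ A, 0 ≤ val A
  lt_sum : ∀ B : Finset V,
    g.val B < ∑ A : DisjointTuple κ V with Finset.univ.biUnion A.1 = B, val A

open Classical in
/-- The colour subweight of colour `i`: its value on `B` is the sum of the values of the
colouring over all tuples with `i`-th entry `B`. -/
def Colouring.subweight {κ : Type w} [Fintype κ] {V : Type u} [Fintype V] {g : Weight V}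
    (c : Colouring κ g) (i : κ) : Weight V where
  val B := ∑ A : DisjointTuple κ V with A.1 i = B, c.val A
  nonneg _ := Finset.sum_nonneg fun A _ => c.nonneg A

/- The weight version of the size Ramsey number. The tuple consists of weights `f i`, `i : Fin q`,
and of graphs `H j`, `j : Fin s`, and the colours are `Fin q ⊕ Fin s`. -/

/-- `g → (f, H)`. -/
def WeightArrows {U : Type v} [Fintype U] (g : Weight U) {q s : ℕ} {V : Fin q → Type u}
    [∀ i, Fintype (V i)] (f : ∀ i, Weight (V i)) (H : Fin s → FinGraph.{u}) : Prop :=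
  ∀ c : Colouring (Fin q ⊕ Fin s) g,
    (∃ i : Fin q, (f i).InWeight (c.subweight (Sum.inl i))) ∨
    (∃ j : Fin s, (H j).InWeight (c.subweight (Sum.inr j)))

/-- The infimum of `e(g)` over the weights `g` on finite sets that arrow the tuple. -/
def weightRamsey {q s : ℕ} {V : Fin q → Type u} [∀ i, Fintype (V i)]
    (f : ∀ i, Weight (V i)) (H : Fin s → FinGraph.{u}) : ℝ :=
  sInf {e : ℝ | ∃ (m : ℕ) (g : Weight (Fin m)), WeightArrows g f H ∧ g.size = e}

/-- The tuple of forbidden graphs: the bipartite graphs `F i`, then the graphs `H j`. -/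
def forbidden {q s : ℕ} {V : Fin q → Type u} [∀ i, Fintype (V i)]
    (F : ∀ i, BipGraph (V i)) (H : Fin s → FinGraph.{u}) : Fin q ⊕ Fin s → FinGraph.{u} :=
  Sum.elim (fun i => (F i).toFinGraph) H

/-- The largest deviation `max_{i, A} | |F_i^A| - f_{i,A} n |` (a maximum over a finite set). -/
def maxDeviation {q : ℕ} {V : Fin q → Type u} (f : ∀ i, Weight (V i))
    (F : ∀ i, BipGraph (V i)) (n : ℕ) : ℝ :=
  ⨆ (i : Fin q) (A : Finset (V i)), |(((F i).fiber A).card : ℝ) - (f i).val A * n|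

end SizeRamsey

end

open SizeRamsey

universe u

/-!
Graphs and weights are translated into each other. Fix a scale `t`.

A weight `g` on `U` becomes the bipartite graph on `U` and about `t g_B` further vertices of
neighbourhood `B`, for each `B ⊆ U`; it has `t e(g) + O(1)` edges. In a labelling of its edges, each
further vertex sees a tuple of disjoint colour neighbourhoods, and counting these tuples gives a
colouring of `g` (`countColouring`). If `f i` is contained in a colour subweight, rounding the
numbers `w_AB` gives a copy of the dilated graph (`graphArrows_of_weightArrows`).

Conversely, let `G` be an optimal graph for scale `n`. It has `O(n)` edges, because some weight
arrows the tuple (`exists_weightArrows`), so the set `L` of its vertices whose degree is at least a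
small multiple of `n` has bounded size. Copies of the dilated graphs have their first part in `L`,
since no element of `f i` is isolated. Hence edges not between `L` and its complement may all be
given the colour of one dilated graph, and `G` arrows the tuple only through the edges between `L`
and its complement, which are described by the weight `neighbourWeight` on `L`
(`weightArrows_neighbourWeight`).

In both directions, roundings and deviations of the fibres are absorbed by shifting `t` away from
`n` by a constant multiple of the deviation plus one. The error terms depend on the number of
elements of the weight. For the lower bound this is the size of `L`, hence bounded. For the upper
bound, weights of size close to the infimum may have many elements; but going from such a weight to
a graph, for much larger `n`, and back yields one on boundedly many elements
(`exists_bounded_weight`). No weight attaining the infimum is needed: for each `n` one of size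
within `1 / n` of it is used.
-/

namespace SizeRamsey

universe v w

/-! ### Assignments with prescribed fibres -/

/-- A map `β` lifts injectively through `τ` if its fibres are no larger than those of `τ`. -/
lemma exists_injective_comp_eq {Y S T : Type*} [Fintype Y] [Fintype S] [DecidableEq T]
    (β : Y → T) (τ : S → T)
    (h : ∀ b, (Finset.univ.filter fun y => β y = b).card ≤
      (Finset.univ.filter fun s => τ s = b).card) :
    ∃ ι : Y → S, Function.Injective ι ∧ ∀ y, τ (ι y) = β y := by
  have h' : ∀ b, Nonempty ({y // β y = b} ↪ {s // τ s = b}) := fun b => by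
    apply Function.Embedding.nonempty_of_card_le
    rw [Fintype.card_subtype, Fintype.card_subtype]
    exact h b
  have e := fun b => (h' b).some
  have key : ∀ b (x : {y // β y = b}), (e b x).1 = (e (β x.1) ⟨x.1, rfl⟩).1 := by
    rintro b ⟨y, rfl⟩
    rfl
  have hτ : ∀ y, τ (e (β y) ⟨y, rfl⟩).1 = β y := fun y => (e (β y) ⟨y, rfl⟩).2
  refine ⟨fun y => (e (β y) ⟨y, rfl⟩).1, fun y y' hyy => ?_, hτ⟩
  have hβ : β y' = β y := by rw [← hτ y, ← hτ y']; exact congrArg τ hyy.symm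
  have h2 := key (β y) ⟨y', hβ⟩
  have h3 : e (β y) ⟨y', hβ⟩ = e (β y) ⟨y, rfl⟩ := Subtype.ext (h2.trans hyy.symm)
  exact (congrArg Subtype.val ((e (β y)).injective h3)).symm

lemma card_filter_sigma_fst_eq {T : Type*} [Fintype T] [DecidableEq T] (N : T → ℕ) (b : T) :
    (Finset.univ.filter fun x : (Σ b, Fin (N b)) => x.1 = b).card = N b := by
  have : (Finset.univ.filter fun x : (Σ b, Fin (N b)) => x.1 = b) =
      Finset.univ.map (Function.Embedding.sigmaMk (β := fun b => Fin (N b)) b) := by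
    ext ⟨b', k⟩
    simp only [Finset.mem_filter, Finset.mem_univ, true_and, Finset.mem_map]
    constructor
    · rintro rfl
      exact ⟨k, rfl⟩
    · rintro ⟨k', hk'⟩
      exact (congrArg Sigma.fst hk').symm
  rw [this, Finset.card_map, Finset.card_univ, Fintype.card_fin]

/-- If, over every `i`, the total capacity of the targets suffices, then the sources can be
assigned to targets over the same index without exceeding any capacity. -/
lemma exists_map_fiber_card_le {S T I : Type*} [Fintype S] [Fintype T] [DecidableEq T]
    [DecidableEq I] (a : S → I) (b : T → I) (cap : T → ℕ)
    (h : ∀ i, (Finset.univ.filter fun x => a x = i).card ≤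
      ∑ t ∈ Finset.univ.filter (fun t => b t = i), cap t) :
    ∃ φ : S → T, (∀ x, b (φ x) = a x) ∧
      ∀ t, (Finset.univ.filter fun x => φ x = t).card ≤ cap t := by
  obtain ⟨ι, hι, hb⟩ := exists_injective_comp_eq a (fun p : (Σ t, Fin (cap t)) => b p.1) (by
    intro i
    refine (h i).trans (le_of_eq ?_)
    have : (Finset.univ.filter fun p : (Σ t, Fin (cap t)) => b p.1 = i) =
        (Finset.univ.filter fun t => b t = i).sigma fun _ => Finset.univ := by
      ext ⟨t, k⟩
      simp
    rw [this, Finset.card_sigma]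
    simp)
  refine ⟨fun x => (ι x).1, hb, fun t => ?_⟩
  have : (Finset.univ.filter fun x => (ι x).1 = t).card ≤
      ((Finset.univ : Finset (Fin (cap t))).map
        (Function.Embedding.sigmaMk (β := fun t => Fin (cap t)) t)).card := by
    refine Finset.card_le_card_of_injOn ι ?_ hι.injOn
    intro x hx
    simp only [Finset.coe_filter, Finset.mem_univ, true_and, Set.mem_ofPred_eq] at hx
    simp only [Finset.coe_map, Set.mem_image, Finset.coe_univ, Set.mem_univ, true_and]
    refine ⟨hx ▸ (ι x).2, ?_⟩
    subst hx
    rfl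
  simpa using this

/-! ### Containment of weights without padding -/

/-- The decidability instance is left to unification, to match whichever one a statement uses. -/
lemma sum_filter_eq_sum {ι : Type*} [Fintype ι] {p : ι → Prop} {_ : DecidablePred p} {F : ι → ℝ}
    (h : ∀ i, ¬ p i → F i = 0) : ∑ i with p i, F i = ∑ i, F i :=
  Finset.sum_filter_of_ne fun i _ hi => by_contra fun h' => hi (h i h')

lemma toRight_map_inl {U X : Type*} (B : Finset U) :
    (B.map (Function.Embedding.inl : U ↪ U ⊕ X)).toRight = ∅ := by
  ext
  simp

lemma toLeft_map_inl {U X : Type*} (B : Finset U) :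
    (B.map (Function.Embedding.inl : U ↪ U ⊕ X)).toLeft = B := by
  ext
  simp

lemma sum_eq_sum_map_inl {U X : Type*} [Fintype U] [Fintype X] (F : Finset (U ⊕ X) → ℝ)
    (hF : ∀ B, B.toRight.card ≠ 0 → F B = 0) :
    ∑ B, F B = ∑ B : Finset U, F (B.map Function.Embedding.inl) := by
  symm
  refine Finset.sum_of_injOn (fun B => B.map Function.Embedding.inl)
    (Finset.map_injective _).injOn (by simp) ?_ (fun _ _ => rfl)
  intro B _ hB
  apply hF
  intro h0
  apply hB
  refine ⟨B.toLeft, by simp, ?_⟩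
  ext x
  rcases x with x | x
  · simp
  · have : x ∉ B.toRight := by
      rw [Finset.card_eq_zero.mp h0]; simp
    simpa using this

variable {V : Type u} {U : Type v} [Fintype V] [Fintype U]

open Classical in
lemma Weight.inWeight_of_embedding {f : Weight V} {g : Weight U} (h : V ↪ U)
    (w : Finset V → Finset U → ℝ) (nonneg : ∀ A B, 0 ≤ w A B)
    (eq_zero : ∀ A B, ¬ A.map h ⊆ B → w A B = 0) (le_sum : ∀ A, f.val A ≤ ∑ B, w A B)
    (sum_le : ∀ B, ∑ A, w A B ≤ g.val B) : f.InWeight g := by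
  have hmap : ∀ (A : Finset V) (B : Finset (U ⊕ Fin (Fintype.card V - Fintype.card U))),
      A.map (h.trans Function.Embedding.inl) ⊆ B ↔ A.map h ⊆ B.toLeft := by
    intro A B
    simp [Finset.subset_iff]
  have hz : ∀ (A : Finset V) (B : Finset (U ⊕ Fin (Fintype.card V - Fintype.card U))),
      ¬ A.map (h.trans Function.Embedding.inl) ⊆ B →
      (if B.toRight.card = 0 then w A B.toLeft else 0) = 0 := by
    intro A B hAB
    rw [hmap] at hAB
    rw [eq_zero _ _ hAB, ite_self]
  refine ⟨h.trans Function.Embedding.inl,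
    fun A B => if B.toRight.card = 0 then w A B.toLeft else 0, ?_, hz, ?_, ?_⟩
  · intro A B
    split_ifs
    · exact nonneg _ _
    · exact le_rfl
  · intro A
    rw [sum_filter_eq_sum (hz A),
      sum_eq_sum_map_inl _ (fun B hB => if_neg hB)]
    refine (le_sum A).trans (le_of_eq (Finset.sum_congr rfl fun B _ => ?_))
    rw [toRight_map_inl, toLeft_map_inl]
    simp
  · intro B
    rw [sum_filter_eq_sum (fun A => hz A B)]
    simp only [Weight.pad]
    split_ifs
    · exact sum_le _
    · simp

/-- If `f` has no isolated elements then padding `V(g)` does not help to embed `f` into `g`. -/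
lemma Weight.InWeight.exists_embedding {f : Weight V} {g : Weight U} (hfg : f.InWeight g)
    (hf : f.NoIsolated) :
    ∃ (h : V ↪ U) (w : Finset V → Finset U → ℝ), (∀ A B, 0 ≤ w A B) ∧
      (∀ A B, ¬ A.map h ⊆ B → w A B = 0) ∧ (∀ A, f.val A ≤ ∑ B, w A B) ∧
      ∀ B, ∑ A, w A B ≤ g.val B := by
  classical
  obtain ⟨h, w, nonneg, eq_zero, le_sum, sum_le⟩ := hfg
  have le_sum' : ∀ A, f.val A ≤ ∑ B, w A B := fun A => by
    exact (le_sum A).trans (le_of_eq (sum_filter_eq_sum (eq_zero A)))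
  have sum_le' : ∀ B, ∑ A, w A B ≤ (g.pad (Fin (Fintype.card V - Fintype.card U))).val B :=
    fun B => by
      exact le_trans (le_of_eq (sum_filter_eq_sum (fun A => eq_zero A B)).symm) (sum_le B)
  have hz : ∀ A B, B.toRight.card ≠ 0 → w A B = 0 := by
    intro A B hB
    have h1 := sum_le' B
    simp only [Weight.pad, if_neg hB] at h1
    exact le_antisymm ((Finset.single_le_sum (fun A _ => nonneg A B) (Finset.mem_univ A)).trans h1)
      (nonneg A B)
  have hex : ∀ x, ∃ y, h x = Sum.inl y := by
    intro x
    rcases hx : h x with y | j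
    · exact ⟨y, rfl⟩
    · exfalso
      obtain ⟨A, hA, hA0⟩ := Finset.exists_ne_zero_of_sum_ne_zero (hf x)
      refine hA0 (le_antisymm ((le_sum' A).trans (le_of_eq ?_)) (f.nonneg A))
      refine Finset.sum_eq_zero fun B _ => ?_
      by_cases hAB : A.map h ⊆ B
      · apply hz
        have : j ∈ B.toRight := by
          rw [Finset.mem_toRight]
          apply hAB
          rw [← hx]
          exact Finset.mem_map_of_mem h (by simpa using hA)
        exact Finset.card_ne_zero_of_mem this
      · exact eq_zero A B hAB
  choose h' hh' using hex
  refine ⟨⟨h', fun x y hxy => h.injective (by rw [hh', hh', hxy])⟩,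
    fun A B => w A (B.map Function.Embedding.inl), fun A B => nonneg _ _, ?_, ?_, ?_⟩
  · intro A B hAB
    apply eq_zero
    contrapose! hAB
    intro y hy
    obtain ⟨x, hx, rfl⟩ := Finset.mem_map.mp hy
    have := hAB (Finset.mem_map_of_mem h hx)
    rw [hh'] at this
    exact Finset.mem_map' Function.Embedding.inl |>.mp this
  · intro A
    rw [← sum_eq_sum_map_inl (w A) (hz A)]
    exact le_sum' A
  · intro B
    refine (sum_le' _).trans (le_of_eq ?_)
    simp only [Weight.pad, toRight_map_inl, toLeft_map_inl]
    simp

/-! ### From an arrowing weight to an arrowing graph -/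

/-- The decidability instances are left to unification, to match whichever ones a statement uses. -/
lemma card_filter_comp {S T : Type*} [Fintype S] [Fintype T] [DecidableEq T] (τ : S → T)
    (p : T → Prop) {_ : DecidablePred p} {_ : DecidablePred fun x => p (τ x)} :
    (Finset.univ.filter fun x => p (τ x)).card =
      ∑ t ∈ Finset.univ.filter p, (Finset.univ.filter fun x => τ x = t).card := by
  rw [Finset.card_eq_sum_card_fiberwise (f := τ) (t := Finset.univ.filter p)
    (fun x hx => by simpa using hx)]
  refine Finset.sum_congr rfl fun t ht => ?_
  congr 1
  ext x
  simp only [Finset.mem_filter, Finset.mem_univ, true_and] at ht ⊢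
  constructor
  · exact fun h => h.2
  · rintro rfl
    exact ⟨ht, rfl⟩

open Classical in
/-- The colouring of a weight obtained by counting the colour tuples `τ x`, discarding `C₀` of each
kind, and rescaling by `t`. Discarding makes every tuple of positive value occur more than `C₀`
times. -/
noncomputable def countColouring {κ : Type w} [Fintype κ] {U : Type v} [Fintype U] (g : Weight U)
    {S : Type*} [Fintype S] (τ : S → DisjointTuple κ U) (t : ℝ) (ht : 0 < t) (C₀ : ℕ)
    (hτ : ∀ B, t * g.val B + Nat.card (DisjointTuple κ U) * C₀ <
      (Finset.univ.filter fun x => Finset.univ.biUnion (τ x).1 = B).card) : Colouring κ g where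
  val A := max (((Finset.univ.filter fun x => τ x = A).card : ℝ) - C₀) 0 / t
  nonneg A := by positivity
  lt_sum B := by
    rw [← Finset.sum_div, lt_div_iff₀ ht]
    have h1 := hτ B
    rw [card_filter_comp τ (fun A => Finset.univ.biUnion A.1 = B)] at h1
    push_cast at h1
    have h2 : ∑ A : DisjointTuple κ U with Finset.univ.biUnion A.1 = B,
          (((Finset.univ.filter fun x => τ x = A).card : ℝ) - C₀) ≤
        ∑ A : DisjointTuple κ U with Finset.univ.biUnion A.1 = B,
          max (((Finset.univ.filter fun x => τ x = A).card : ℝ) - C₀) 0 :=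
      Finset.sum_le_sum fun A _ => le_max_left _ _
    rw [Finset.sum_sub_distrib, Finset.sum_const, nsmul_eq_mul] at h2
    have h3 : ((Finset.univ.filter fun A : DisjointTuple κ U =>
        Finset.univ.biUnion A.1 = B).card : ℝ) ≤ Nat.card (DisjointTuple κ U) := by
      rw [Nat.card_eq_fintype_card]
      exact_mod_cast Finset.card_le_univ _
    have h4 := mul_le_mul_of_nonneg_right h3 (Nat.cast_nonneg (α := ℝ) C₀)
    linarith

section

variable {κ : Type w} [Fintype κ] {U : Type v} [Fintype U] {g : Weight U}
    {S : Type*} [Fintype S] {τ : S → DisjointTuple κ U} {t : ℝ} {ht : 0 < t} {C₀ : ℕ}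

open Classical in
lemma mul_countColouring_subweight_le
    {hτ : ∀ B, t * g.val B + Nat.card (DisjointTuple κ U) * C₀ <
      (Finset.univ.filter fun x => Finset.univ.biUnion (τ x).1 = B).card} (i : κ) (B : Finset U) :
    t * ((countColouring g τ t ht C₀ hτ).subweight i).val B ≤
      (Finset.univ.filter fun x => (τ x).1 i = B).card := by
  rw [card_filter_comp τ (fun A => A.1 i = B)]
  push_cast
  simp only [Colouring.subweight, countColouring]
  rw [← Finset.sum_div, mul_div_cancel₀ _ ht.ne']
  refine Finset.sum_le_sum fun A _ => max_le ?_ (Nat.cast_nonneg _)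
  linarith [Nat.cast_nonneg (α := ℝ) C₀]

open Classical in
lemma lt_card_of_countColouring_subweight_pos
    {hτ : ∀ B, t * g.val B + Nat.card (DisjointTuple κ U) * C₀ <
      (Finset.univ.filter fun x => Finset.univ.biUnion (τ x).1 = B).card} {i : κ} {B : Finset U}
    (h : 0 < ((countColouring g τ t ht C₀ hτ).subweight i).val B) :
    C₀ < (Finset.univ.filter fun x => (τ x).1 i = B).card := by
  obtain ⟨A, hA, hpos⟩ := Finset.exists_lt_of_sum_lt
    (lt_of_eq_of_lt (Finset.sum_const_zero) h)
  simp only [countColouring] at hpos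
  have h1 : C₀ < (Finset.univ.filter fun x => τ x = A).card := by
    by_contra! hle
    have : (((Finset.univ.filter fun x => τ x = A).card : ℝ) - C₀) ≤ 0 := by
      have : ((Finset.univ.filter fun x => τ x = A).card : ℝ) ≤ C₀ := by exact_mod_cast hle
      linarith
    rw [max_eq_right this, zero_div] at hpos
    exact lt_irrefl _ hpos
  refine h1.trans_le (Finset.card_le_card fun x hx => ?_)
  simp only [Finset.mem_filter, Finset.mem_univ, true_and] at hA hx ⊢
  rw [hx, hA]

end

lemma BipGraph.mem_fiber {V : Type u} (F : BipGraph V) {A : Finset V} {y : F.V₂} :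
    y ∈ F.fiber A ↔ ∀ x, x ∈ A ↔ F.Adj x y := by
  simp [BipGraph.fiber]

open Classical in
lemma BipGraph.card_fiber {V : Type u} [Fintype V] (F : BipGraph V) (A : Finset V) :
    (F.fiber A).card =
      (Finset.univ.filter fun y => (Finset.univ.filter fun x => F.Adj x y) = A).card := by
  congr 1
  ext y
  simp only [BipGraph.fiber, Finset.mem_filter, Finset.mem_univ, true_and, Finset.ext_iff]
  exact forall_congr' fun x => Iff.comm

open Classical in
/-- Rounding an embedding of weights: if the fibres of `F` are slightly smaller than those of
`t • f`, the vertices of the second part of `F` can be sent injectively to elements whose colour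
class contains the image of their neighbourhood. -/
lemma BipGraph.exists_injective_of_weight {V : Type u} [Fintype V] {U : Type v} [Fintype U]
    (F : BipGraph V) {f : Weight V} {h : V ↪ U} {w : Finset V → Finset U → ℝ} {t : ℝ}
    {S : Type*} [Fintype S] (σ : S → Finset U) (ht : 0 < t) (hF : F.Agrees f)
    (hcard : ∀ A, f.val A ≠ 0 → ((F.fiber A).card : ℝ) + Fintype.card (Finset U) ≤ f.val A * t)
    (nonneg : ∀ A B, 0 ≤ w A B) (eq_zero : ∀ A B, ¬ A.map h ⊆ B → w A B = 0)
    (le_sum : ∀ A, f.val A ≤ ∑ B, w A B)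
    (sum_le : ∀ B, t * ∑ A, w A B ≤ (Finset.univ.filter fun x => σ x = B).card) :
    ∃ ι : F.V₂ → S, Function.Injective ι ∧ ∀ x y, F.Adj x y → h x ∈ σ (ι y) := by
  -- Each `y` gets a pair `(A, B)` with `A` its neighbourhood; at most `⌊t w_AB⌋` get `(A, B)`.
  -- Rounding loses at most one per `B`, which `hcard` makes up for.
  obtain ⟨φ, hφ, hcap⟩ := exists_map_fiber_card_le
    (fun y : F.V₂ => Finset.univ.filter fun x => F.Adj x y)
    (fun p : Finset V × Finset U => p.1) (fun p => ⌊t * w p.1 p.2⌋₊) (by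
      intro A
      rw [← F.card_fiber A]
      by_cases hA : f.val A = 0
      · rw [(hF A).mpr hA]
        simp
      have h1 : ∑ p : Finset V × Finset U with p.1 = A, ⌊t * w p.1 p.2⌋₊ =
          ∑ B, ⌊t * w A B⌋₊ := by
        symm
        refine Finset.sum_of_injOn (fun B => (A, B)) (fun B _ B' _ hB => (Prod.ext_iff.mp hB).2)
          (by simp [Set.MapsTo]) ?_ (fun _ _ => rfl)
        rintro ⟨A', B⟩ hp hn
        simp only [Finset.mem_filter, Finset.mem_univ, true_and] at hp
        subst hp
        exact absurd ⟨B, by simp, rfl⟩ hn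
      rw [h1]
      have h2 : t * ∑ B, w A B ≤ ∑ B, ((⌊t * w A B⌋₊ : ℝ) + 1) := by
        rw [Finset.mul_sum]
        exact Finset.sum_le_sum fun B _ => (Nat.lt_floor_add_one _).le
      rw [Finset.sum_add_distrib, Finset.sum_const, Finset.card_univ, nsmul_eq_mul, mul_one] at h2
      have h3 := mul_le_mul_of_nonneg_left (le_sum A) ht.le
      have h4 := hcard A hA
      have h5 : ((F.fiber A).card : ℝ) ≤ ∑ B, (⌊t * w A B⌋₊ : ℝ) := by linarith
      exact_mod_cast h5)
  obtain ⟨ι, hι, hσ⟩ := exists_injective_comp_eq (fun y => (φ y).2) σ (by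
    intro B
    have h1 : (Finset.univ.filter fun y => (φ y).2 = B).card ≤ ∑ A, ⌊t * w A B⌋₊ := by
      rw [Finset.card_eq_sum_card_fiberwise (f := fun y => (φ y).1) (t := Finset.univ)
        (fun _ _ => Finset.mem_coe.mpr (Finset.mem_univ _))]
      refine Finset.sum_le_sum fun A _ =>
        le_trans (Finset.card_le_card fun y hy => ?_) (hcap (A, B))
      simp only [Finset.mem_filter, Finset.mem_univ, true_and] at hy ⊢
      exact Prod.ext hy.2 hy.1
    have h2 : ((∑ A, ⌊t * w A B⌋₊ : ℕ) : ℝ) ≤ t * ∑ A, w A B := by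
      push_cast
      rw [Finset.mul_sum]
      exact Finset.sum_le_sum fun A _ => Nat.floor_le (mul_nonneg ht.le (nonneg _ _))
    have h3 := h2.trans (sum_le B)
    exact h1.trans (by exact_mod_cast h3))
  refine ⟨ι, hι, fun x y hxy => ?_⟩
  rw [hσ]
  have hpos : 0 < ⌊t * w (φ y).1 (φ y).2⌋₊ := by
    refine lt_of_lt_of_le (Finset.card_pos.mpr ⟨y, ?_⟩) (hcap (φ y))
    simp
  have hsub : (φ y).1.map h ⊆ (φ y).2 := by
    by_contra hn
    rw [eq_zero _ _ hn] at hpos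
    simp at hpos
  apply hsub
  apply Finset.mem_map_of_mem
  rw [hφ]
  simpa using hxy

open Classical in
/-- A graph which contains, for every `B ⊆ V(g)`, slightly more than `t g_B` vertices joined to all
of `B` arrows the tuple as soon as `g` does. The excess over `t g_B` pays for the occurrences
discarded in `countColouring`; thanks to these, a graph `H j` contained in a colour subweight finds
room for all its vertices. -/
lemma graphArrows_of_weightArrows {q s : ℕ} {V : Fin q → Type u} [∀ i, Fintype (V i)]
    {f : ∀ i, Weight (V i)} {H : Fin s → FinGraph.{u}} (hf : ∀ i, (f i).NoIsolated)
    {U : Type v} [Fintype U] {g : Weight U} (hg : WeightArrows g f H)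
    {F : ∀ i, BipGraph (V i)} (hF : ∀ i, (F i).Agrees (f i)) {t : ℝ} (ht : 0 < t)
    (hcard : ∀ i A, (f i).val A ≠ 0 →
      (((F i).fiber A).card : ℝ) + Fintype.card (Finset U) ≤ (f i).val A * t)
    {C₀ : ℕ} (hC₀ : ∀ j, Fintype.card (H j).V ≤ C₀)
    {W S : Type*} [Fintype S] (G : SimpleGraph W) (ψ : U ⊕ S ↪ W) (nb : S → Finset U)
    (hadj : ∀ x, ∀ k ∈ nb x, G.Adj (ψ (Sum.inl k)) (ψ (Sum.inr x)))
    (hnb : ∀ B, t * g.val B + Nat.card (DisjointTuple (Fin q ⊕ Fin s) U) * C₀ <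
      (Finset.univ.filter fun x => nb x = B).card) :
    GraphArrows G (forbidden F H) := by
  intro c
  -- entry `i` consists of the neighbours of `x` along the edges of colour `i`
  let τ : S → DisjointTuple (Fin q ⊕ Fin s) U := fun x =>
    ⟨fun i => (nb x).filter fun k => ∃ h : s(ψ (Sum.inl k), ψ (Sum.inr x)) ∈ G.edgeSet,
      c ⟨_, h⟩ = i, by
      intro i j hij
      rw [Finset.disjoint_left]
      intro k hk hk'
      simp only [Finset.mem_filter] at hk hk'
      obtain ⟨-, h, hi⟩ := hk
      obtain ⟨-, h', hj⟩ := hk'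
      exact hij (hi.symm.trans hj)⟩
  have hτ : ∀ x, Finset.univ.biUnion (τ x).1 = nb x := by
    intro x
    ext k
    simp only [Finset.mem_biUnion, Finset.mem_univ, true_and, τ, Finset.mem_filter]
    constructor
    · rintro ⟨i, h, -⟩
      exact h
    · intro hk
      exact ⟨_, hk, hadj x k hk, rfl⟩
  have hlab : ∀ i x k, k ∈ (τ x).1 i →
      (c.labelGraph i).Adj (ψ (Sum.inl k)) (ψ (Sum.inr x)) := by
    intro i x k hk
    simp only [τ, Finset.mem_filter] at hk
    rw [SimpleGraph.EdgeLabeling.labelGraph, SimpleGraph.fromEdgeSet_adj]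
    exact ⟨hk.2, fun h => by simpa using ψ.injective h⟩
  have hτ' : ∀ B, t * g.val B + Nat.card (DisjointTuple (Fin q ⊕ Fin s) U) * C₀ <
      (Finset.univ.filter fun x => Finset.univ.biUnion (τ x).1 = B).card := by
    simpa only [hτ] using hnb
  rcases hg (countColouring g τ t ht C₀ hτ') with ⟨i, hi⟩ | ⟨j, P, hP, h, hh⟩
  · obtain ⟨h, w, nonneg, eq_zero, le_sum, sum_le⟩ := hi.exists_embedding (hf i)
    obtain ⟨ι, hι, hadj'⟩ := (F i).exists_injective_of_weight (fun x => (τ x).1 (Sum.inl i)) ht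
      (hF i) (hcard i) nonneg eq_zero le_sum (fun B =>
        (mul_le_mul_of_nonneg_left (sum_le B) ht.le).trans (mul_countColouring_subweight_le _ _))
    refine ⟨Sum.inl i, ⟨⟨⟨fun z => ψ (Sum.map h ι z), ?_⟩, ?_⟩⟩⟩
    · rintro a b (⟨x, y, rfl, rfl, hxy⟩ | ⟨x, y, rfl, rfl, hxy⟩)
      · exact hlab _ _ _ (hadj' x y hxy)
      · exact (hlab _ _ _ (hadj' x y hxy)).symm
    · exact ψ.injective.comp (Sum.map_injective.mpr ⟨h.injective, hι⟩)
  · have hB : ∀ y : {y // y ∉ P}, ∃ B : Finset U,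
        (∀ x : P, (H j).graph.Adj y x → h x ∈ B) ∧
        0 < ((countColouring g τ t ht C₀ hτ').subweight (Sum.inr j)).val B := by
      rintro ⟨y, hy⟩
      obtain ⟨B, hB, hpos⟩ := hh (Finset.univ.filter fun x : P => (H j).graph.Adj y x)
        ⟨y, hy, fun x hx => by simpa using hx⟩
      exact ⟨B, fun x hx => hB (Finset.mem_map_of_mem h (by simpa using hx)), hpos⟩
    choose β hβ hpos using hB
    obtain ⟨ι, hι, hσ⟩ := exists_injective_comp_eq β (fun x => (τ x).1 (Sum.inr j)) (by
      intro B
      by_cases hne : ∃ y, β y = B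
      · obtain ⟨y, rfl⟩ := hne
        refine le_trans ?_ (lt_card_of_countColouring_subweight_pos (hpos y)).le
        exact (Finset.card_le_univ _).trans ((Fintype.card_subtype_le _).trans (hC₀ j))
      · rw [Finset.filter_eq_empty_iff.mpr (fun y _ hy => hne ⟨y, hy⟩)]
        simp)
    let μ : (H j).V → U ⊕ S := fun x =>
      if hx : x ∈ P then Sum.inl (h ⟨x, hx⟩) else Sum.inr (ι ⟨x, hx⟩)
    have hμ1 : ∀ x (hx : x ∈ P), μ x = Sum.inl (h ⟨x, hx⟩) := fun x hx => dif_pos hx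
    have hμ2 : ∀ x (hx : x ∉ P), μ x = Sum.inr (ι ⟨x, hx⟩) := fun x hx => dif_neg hx
    refine ⟨Sum.inr j, ⟨⟨⟨fun x => ψ (μ x), ?_⟩, ψ.injective.comp ?_⟩⟩⟩
    · have key : ∀ x y (hx : x ∈ P) (hy : y ∉ P), (H j).graph.Adj y x →
          (c.labelGraph (Sum.inr j)).Adj (ψ (μ x)) (ψ (μ y)) := by
        intro x y hx hy hxy
        rw [hμ1 x hx, hμ2 y hy]
        apply hlab
        have := hσ ⟨y, hy⟩
        rw [this]
        exact hβ ⟨y, hy⟩ ⟨x, hx⟩ hxy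
      intro x y hxy
      by_cases hx : x ∈ P
      · exact key x y hx ((hP x y hxy).mp hx) hxy.symm
      · have hy : y ∈ P := by_contra fun hy => hx ((hP x y hxy).mpr hy)
        exact (key y x hy hx hxy).symm
    · intro x y hxy
      by_cases hx : x ∈ P <;> by_cases hy : y ∈ P
      · rw [hμ1 x hx, hμ1 y hy] at hxy
        exact congrArg Subtype.val (h.injective (Sum.inl.inj hxy))
      · rw [hμ1 x hx, hμ2 y hy] at hxy
        cases hxy
      · rw [hμ2 x hx, hμ1 y hy] at hxy
        cases hxy
      · rw [hμ2 x hx, hμ2 y hy] at hxy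
        exact congrArg Subtype.val (hι (Sum.inr.inj hxy))

open Classical in
/-- The upper bound: a weight `g` which arrows the tuple yields a bipartite graph with
`t e(g) + O(1)` edges, which has about `t g_B` vertices of neighbourhood `B` for each `B`. -/
lemma exists_graphArrows_ncard_le {q s : ℕ} {V : Fin q → Type u} [∀ i, Fintype (V i)]
    {f : ∀ i, Weight (V i)} {H : Fin s → FinGraph.{u}} (hf : ∀ i, (f i).NoIsolated)
    {U : Type} [Fintype U] {g : Weight U} (hg : WeightArrows g f H)
    {F : ∀ i, BipGraph (V i)} (hF : ∀ i, (F i).Agrees (f i)) {t : ℝ} (ht : 0 < t)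
    (hcard : ∀ i A, (f i).val A ≠ 0 →
      (((F i).fiber A).card : ℝ) + Fintype.card (Finset U) ≤ (f i).val A * t)
    {C₀ : ℕ} (hC₀ : ∀ j, Fintype.card (H j).V ≤ C₀) :
    ∃ (N : ℕ) (G : SimpleGraph (Fin N)), GraphArrows G (forbidden F H) ∧
      (G.edgeSet.ncard : ℝ) ≤ t * g.size +
        ∑ B : Finset U, (1 + Nat.card (DisjointTuple (Fin q ⊕ Fin s) U) * C₀ : ℝ) * B.card := by
  let N : Finset U → ℕ := fun B =>
    ⌊t * g.val B⌋₊ + 1 + Nat.card (DisjointTuple (Fin q ⊕ Fin s) U) * C₀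
  let S := Σ B : Finset U, Fin (N B)
  let ε := Fintype.equivFin (U ⊕ S)
  let D : Finset (Σ _ : S, U) := Finset.univ.sigma fun x => x.1
  let E := D.image fun p => s(ε (Sum.inl p.2), ε (Sum.inr p.1))
  refine ⟨_, SimpleGraph.fromEdgeSet (E : Set (Sym2 (Fin _))),
    graphArrows_of_weightArrows hf hg hF ht hcard hC₀ _ ε.toEmbedding (fun x : S => x.1) ?_ ?_, ?_⟩
  · intro x k hk
    rw [SimpleGraph.fromEdgeSet_adj]
    refine ⟨?_, fun h => by simpa using ε.injective h⟩
    simp only [E, Finset.coe_image]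
    exact ⟨⟨x, k⟩, by simpa [D] using hk, rfl⟩
  · intro B
    have h1 : (Finset.univ.filter fun x : S => x.1 = B).card = N B :=
      card_filter_sigma_fst_eq N B
    rw [h1]
    simp only [N]
    push_cast
    linarith [Nat.lt_floor_add_one (t * g.val B)]
  · have h1 : (SimpleGraph.fromEdgeSet (E : Set (Sym2 (Fin (Fintype.card (U ⊕ S)))))).edgeSet.ncard
        ≤ D.card := by
      rw [SimpleGraph.edgeSet_fromEdgeSet]
      refine (Set.ncard_le_ncard Set.sdiff_subset (Finset.finite_toSet E)).trans ?_
      rw [Set.ncard_coe_finset]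
      exact Finset.card_image_le
    have h2 : D.card = ∑ B, N B * B.card := by
      rw [Finset.card_sigma, Fintype.sum_sigma]
      refine Finset.sum_congr rfl fun B _ => ?_
      simp
    rw [h2] at h1
    have h3 : ((∑ B, N B * B.card : ℕ) : ℝ) ≤ t * g.size +
        ∑ B : Finset U, (1 + Nat.card (DisjointTuple (Fin q ⊕ Fin s) U) * C₀ : ℝ) * B.card := by
      rw [Weight.size, Finset.mul_sum, ← Finset.sum_add_distrib]
      push_cast
      refine Finset.sum_le_sum fun B _ => ?_
      rw [← mul_assoc, ← add_mul]
      refine mul_le_mul_of_nonneg_right ?_ (Nat.cast_nonneg _)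
      simp only [N]
      push_cast
      linarith [Nat.floor_le (mul_nonneg ht.le (g.nonneg B))]
    exact le_trans (by exact_mod_cast h1) h3

/-! ### From an arrowing graph to an arrowing weight -/

open Classical in
/-- Realising a colouring of a weight by vertices: if slightly fewer than `t g_B` vertices `x` have
`nb x = B`, they can be given tuples so that the tuple `A` occurs at most `t c_A` times. -/
lemma Colouring.exists_tuples {κ : Type w} [Fintype κ] {U : Type v} [Fintype U] {g : Weight U}
    (c : Colouring κ g) {S : Type*} [Fintype S] (nb : S → Finset U) {t : ℝ} (ht : 0 < t)
    (hg : ∀ B, ((Finset.univ.filter fun x => nb x = B).card : ℝ) + Nat.card (DisjointTuple κ U) ≤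
      t * g.val B) :
    ∃ φ : S → DisjointTuple κ U, (∀ x, Finset.univ.biUnion (φ x).1 = nb x) ∧
      ∀ i B, ((Finset.univ.filter fun x => (φ x).1 i = B).card : ℝ) ≤
        t * (c.subweight i).val B := by
  obtain ⟨φ, hφ, hcap⟩ := exists_map_fiber_card_le nb
    (fun A : DisjointTuple κ U => Finset.univ.biUnion A.1) (fun A => ⌊t * c.val A⌋₊) (by
      intro B
      have h1 : t * g.val B ≤
          ∑ A : DisjointTuple κ U with Finset.univ.biUnion A.1 = B, ((⌊t * c.val A⌋₊ : ℝ) + 1) := by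
        refine (mul_le_mul_of_nonneg_left (c.lt_sum B).le ht.le).trans ?_
        rw [Finset.mul_sum]
        exact Finset.sum_le_sum fun A _ => (Nat.lt_floor_add_one _).le
      rw [Finset.sum_add_distrib, Finset.sum_const, nsmul_eq_mul, mul_one] at h1
      have h2 : ((Finset.univ.filter fun A : DisjointTuple κ U =>
          Finset.univ.biUnion A.1 = B).card : ℝ) ≤ Nat.card (DisjointTuple κ U) := by
        rw [Nat.card_eq_fintype_card]
        exact_mod_cast Finset.card_le_univ _
      have h3 := hg B
      have h4 : ((Finset.univ.filter fun x => nb x = B).card : ℝ) ≤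
          ∑ A : DisjointTuple κ U with Finset.univ.biUnion A.1 = B, (⌊t * c.val A⌋₊ : ℝ) := by
        linarith
      exact_mod_cast h4)
  refine ⟨φ, hφ, fun i B => ?_⟩
  rw [card_filter_comp φ (fun A => A.1 i = B)]
  push_cast
  simp only [Colouring.subweight]
  rw [Finset.mul_sum]
  refine Finset.sum_le_sum fun A _ => le_trans ?_ (Nat.floor_le (mul_nonneg ht.le (c.nonneg A)))
  exact_mod_cast hcap A

open Classical in
lemma BipGraph.card_fiber_le_ncard_neighborSet {V : Type u} [Fintype V] (F : BipGraph V)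
    {W : Type*} [Finite W] {G : SimpleGraph W} (ι : F.toFinGraph.graph.Copy G) {A : Finset V}
    {x : V} (hx : x ∈ A) :
    (F.fiber A).card ≤ (G.neighborSet (ι (Sum.inl x))).ncard := by
  rw [← Set.ncard_coe_finset]
  refine Set.ncard_le_ncard_of_injOn (fun y => ι (Sum.inr y)) ?_ ?_ (Set.toFinite _)
  · intro y hy
    have hxy : F.Adj x y := (F.mem_fiber.mp hy x).mp hx
    exact ι.toHom.map_rel (a := Sum.inl x) (b := Sum.inr y) (Or.inl ⟨x, y, rfl, rfl, hxy⟩)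
  · intro y _ y' _ h
    exact Sum.inr.inj (ι.injective h)

open Classical in
/-- The vertices outside `range e` of a copy of `F` provide an embedding of weights: the part of
`f` sent to `B` is the number of vertices of the second part that are mapped to vertices of colour
neighbourhood `B`. At most `|U|` vertices are lost, being mapped into `range e`. -/
lemma BipGraph.inWeight_of_map {V : Type u} [Fintype V] {U : Type v} [Fintype U]
    (F : BipGraph V) {f : Weight V} {g : Weight U} {t : ℝ} (ht : 0 < t)
    (hcard : ∀ A, f.val A ≠ 0 → f.val A * t + Fintype.card U ≤ (F.fiber A).card)
    {W : Type*} (e : U ↪ W) (h : V ↪ U) (ι : F.V₂ → W)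
    (hι : Function.Injective ι) [Fintype {v : W // v ∉ Set.range e}]
    (σ : {v : W // v ∉ Set.range e} → Finset U)
    (hσ : ∀ B, ((Finset.univ.filter fun x => σ x = B).card : ℝ) ≤ t * g.val B)
    (hadj : ∀ x y (hy : ι y ∉ Set.range e), F.Adj x y → h x ∈ σ ⟨ι y, hy⟩) :
    f.InWeight g := by
  let Y := {y : F.V₂ // ι y ∉ Set.range e}
  let a : Y → Finset V := fun y => Finset.univ.filter fun x => F.Adj x y.1
  let ι' : Y → {v : W // v ∉ Set.range e} := fun y => ⟨ι y.1, y.2⟩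
  have hι' : Function.Injective ι' := fun y y' hyy =>
    Subtype.ext (hι (congrArg Subtype.val hyy))
  refine Weight.inWeight_of_embedding h
    (fun A B => ((Finset.univ.filter fun y : Y => a y = A ∧ σ (ι' y) = B).card : ℝ) / t)
    (fun A B => by positivity) ?_ ?_ ?_
  · intro A B hAB
    have : (Finset.univ.filter fun y : Y => a y = A ∧ σ (ι' y) = B) = ∅ := by
      rw [Finset.filter_eq_empty_iff]
      rintro y - ⟨rfl, rfl⟩
      apply hAB
      intro k hk
      obtain ⟨x, hx, rfl⟩ := Finset.mem_map.mp hk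
      exact hadj x y.1 y.2 (by simpa [a] using hx)
    simp [this]
  · intro A
    by_cases hA : f.val A = 0
    · rw [hA]
      exact Finset.sum_nonneg fun B _ => by positivity
    rw [← Finset.sum_div, le_div_iff₀ ht]
    have h1 : ∑ B, (Finset.univ.filter fun y : Y => a y = A ∧ σ (ι' y) = B).card =
        (Finset.univ.filter fun y : Y => a y = A).card := by
      rw [Finset.card_eq_sum_card_fiberwise (f := fun y => σ (ι' y)) (t := Finset.univ)
        (fun _ _ => Finset.mem_coe.mpr (Finset.mem_univ _))]
      simp only [Finset.filter_filter]
    have h2 : (F.fiber A).card ≤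
        (Finset.univ.filter fun y : Y => a y = A).card + Fintype.card U := by
      rw [F.card_fiber, ← Finset.card_filter_add_card_filter_not (fun y => ι y ∉ Set.range e)]
      refine add_le_add (le_of_eq ?_) ?_
      · rw [← Finset.card_map (Function.Embedding.subtype _)]
        congr 1
        ext y
        simp only [Finset.mem_filter, Finset.mem_univ, true_and, Finset.mem_map, a,
          Function.Embedding.subtype_apply]
        constructor
        · rintro ⟨h1, h2⟩
          exact ⟨⟨y, h2⟩, h1, rfl⟩
        · rintro ⟨y', h1, rfl⟩
          exact ⟨h1, y'.2⟩
      · rw [← Finset.card_univ, ← Finset.card_map e]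
        refine Finset.card_le_card_of_injOn ι ?_ hι.injOn
        intro y hy
        simpa using (Finset.mem_filter.mp hy).2
    have h3 := hcard A hA
    have h4 : ((F.fiber A).card : ℝ) ≤
        ∑ B, ((Finset.univ.filter fun y : Y => a y = A ∧ σ (ι' y) = B).card : ℝ) +
          Fintype.card U := by
      rw [← h1] at h2
      exact_mod_cast h2
    linarith
  · intro B
    rw [← Finset.sum_div, div_le_iff₀ ht, mul_comm]
    refine le_trans ?_ (hσ B)
    have h1 : ∑ A, (Finset.univ.filter fun y : Y => a y = A ∧ σ (ι' y) = B).card =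
        (Finset.univ.filter fun y : Y => σ (ι' y) = B).card := by
      rw [Finset.card_eq_sum_card_fiberwise (f := a) (t := Finset.univ)
        (fun _ _ => Finset.mem_coe.mpr (Finset.mem_univ _))]
      simp only [Finset.filter_filter, and_comm]
    have h2 : (Finset.univ.filter fun y : Y => σ (ι' y) = B).card ≤
        (Finset.univ.filter fun x => σ x = B).card := by
      refine Finset.card_le_card_of_injOn ι' ?_ hι'.injOn
      intro y hy
      simpa using hy
    rw [← h1] at h2
    exact_mod_cast h2

open Classical in
/-- The weight which records, for each `B ⊆ U`, the number of vertices outside `range e` whose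
neighbours in `range e` are those of `B`, increased by `C₁` and rescaled by `t`. -/
noncomputable def neighbourWeight {U : Type v} [Fintype U] {W : Type*} [Fintype W]
    (G : SimpleGraph W) (e : U ↪ W) (C₁ : ℕ) {t : ℝ} (ht : 0 < t) : Weight U where
  val B := ((Finset.univ.filter fun v : {v : W // v ∉ Set.range e} =>
    (Finset.univ.filter fun k => G.Adj (e k) v) = B).card + C₁ : ℝ) / t
  nonneg B := by positivity

open Classical in
lemma neighbourWeight_size_mul_le {U : Type v} [Fintype U] {W : Type*} [Fintype W]
    (G : SimpleGraph W) (e : U ↪ W) (C₁ : ℕ) {t : ℝ} (ht : 0 < t) :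
    (neighbourWeight G e C₁ ht).size * t ≤
      G.edgeSet.ncard + ∑ B : Finset U, (C₁ : ℝ) * B.card := by
  let S := {v : W // v ∉ Set.range e}
  let nb : S → Finset U := fun v => Finset.univ.filter fun k => G.Adj (e k) v
  have h1 : (neighbourWeight G e C₁ ht).size * t =
      ∑ B : Finset U, ((Finset.univ.filter fun v => nb v = B).card : ℝ) * B.card +
        ∑ B : Finset U, (C₁ : ℝ) * B.card := by
    rw [Weight.size, Finset.sum_mul, ← Finset.sum_add_distrib]
    refine Finset.sum_congr rfl fun B _ => ?_
    simp only [neighbourWeight, nb, S]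
    field_simp
  rw [h1]
  gcongr
  have h2 : ∑ B : Finset U, (Finset.univ.filter fun v => nb v = B).card * B.card =
      ((Finset.univ : Finset S).sigma nb).card := by
    rw [Finset.card_sigma, ← Finset.sum_fiberwise Finset.univ nb]
    refine Finset.sum_congr rfl fun B _ => ?_
    rw [Finset.sum_congr rfl (g := fun _ => B.card), Finset.sum_const, smul_eq_mul]
    intro v hv
    rw [(Finset.mem_filter.mp hv).2]
  have h3 : ((Finset.univ : Finset S).sigma nb).card ≤ G.edgeSet.ncard := by
    rw [← Set.ncard_coe_finset]
    refine Set.ncard_le_ncard_of_injOn (fun p => s(e p.2, p.1.1)) ?_ ?_ (Set.toFinite _)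
    · rintro ⟨v, k⟩ hp
      simpa [nb] using hp
    · rintro ⟨v, k⟩ - ⟨v', k'⟩ - h
      simp only [Sym2.eq_iff] at h
      rcases h with ⟨h, h'⟩ | ⟨h, h'⟩
      · obtain rfl := e.injective h
        obtain rfl := Subtype.ext h'
        rfl
      · exact absurd ⟨k, h⟩ v'.2
  rw [← h2] at h3
  exact_mod_cast h3

open Classical in
/-- The lower bound. If `G` arrows the graphs, and the image of `e` contains every vertex of large
degree, then `neighbourWeight` arrows the weights. A colouring of the weight is turned into a
labelling of the edges between `range e` and its complement, and all other edges get the colour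
`i₀`. In that colour they do no harm: the first part of a copy of `F i₀` lies in `range e`, because
its vertices have large degree, so edges outside `range e` are not used, and at most `|U|` vertices
of the second part lie in `range e`. In the other colours these edges do not occur. -/
lemma weightArrows_neighbourWeight {q s : ℕ} {V : Fin q → Type u} [∀ i, Fintype (V i)]
    {f : ∀ i, Weight (V i)} {H : Fin s → FinGraph.{u}} (hf : ∀ i, (f i).NoIsolated) (i₀ : Fin q)
    {F : ∀ i, BipGraph (V i)} {U : Type v} [Fintype U] {W : Type*} [Fintype W]
    {G : SimpleGraph W} (hG : GraphArrows G (forbidden F H)) (e : U ↪ W) {t : ℝ} (ht : 0 < t)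
    (hcard : ∀ i A, (f i).val A ≠ 0 →
      (f i).val A * t + Fintype.card U ≤ ((F i).fiber A).card)
    (hdeg : ∀ i A, (f i).val A ≠ 0 → ∀ v,
      ((F i).fiber A).card ≤ (G.neighborSet v).ncard → v ∈ Set.range e) :
    WeightArrows (neighbourWeight G e (Nat.card (DisjointTuple (Fin q ⊕ Fin s) U)) ht) f H := by
  intro c
  obtain ⟨φ, hφ, hcount⟩ := c.exists_tuples
    (fun v : {v : W // v ∉ Set.range e} => Finset.univ.filter fun k => G.Adj (e k) v) ht
    (fun B => by
      simp only [neighbourWeight]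
      rw [mul_div_cancel₀ _ ht.ne'])
  have hlab : ∀ ed : G.edgeSet, ∃ i : Fin q ⊕ Fin s,
      (∀ k (v : {v : W // v ∉ Set.range e}), ed.1 = s(e k, v.1) → k ∈ (φ v).1 i) ∧
      ((¬ ∃ k, ∃ v : {v : W // v ∉ Set.range e}, ed.1 = s(e k, v.1)) → i = Sum.inl i₀) := by
    rintro ⟨ed, hed⟩
    by_cases hex : ∃ k, ∃ v : {v : W // v ∉ Set.range e}, ed = s(e k, v.1)
    · obtain ⟨k, v, rfl⟩ := hex
      have hk : k ∈ Finset.univ.biUnion (φ v).1 := by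
        rw [hφ]
        simpa using hed
      obtain ⟨i, -, hi⟩ := Finset.mem_biUnion.mp hk
      refine ⟨i, fun k' v' h => ?_, fun h => absurd ⟨k, v, rfl⟩ h⟩
      rcases Sym2.eq_iff.mp h with ⟨h1, h2⟩ | ⟨h1, h2⟩
      · obtain rfl := e.injective h1
        obtain rfl := Subtype.ext h2
        exact hi
      · exact absurd ⟨k, h1⟩ v'.2
    · exact ⟨Sum.inl i₀, fun k v h => absurd ⟨k, v, h⟩ hex, fun _ => rfl⟩
  obtain ⟨lab, hlab⟩ : ∃ lab : G.EdgeLabeling (Fin q ⊕ Fin s), ∀ ed : G.edgeSet,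
      (∀ k (v : {v : W // v ∉ Set.range e}), ed.1 = s(e k, v.1) → k ∈ (φ v).1 (lab ed)) ∧
      ((¬ ∃ k, ∃ v : {v : W // v ∉ Set.range e}, ed.1 = s(e k, v.1)) → lab ed = Sum.inl i₀) :=
    ⟨fun ed => (hlab ed).choose, fun ed => (hlab ed).choose_spec⟩
  have hmem : ∀ i k (v : {v : W // v ∉ Set.range e}),
      (lab.labelGraph i).Adj (e k) v → k ∈ (φ v).1 i := by
    intro i k v h
    rw [SimpleGraph.EdgeLabeling.labelGraph, SimpleGraph.fromEdgeSet_adj] at h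
    obtain ⟨⟨h, rfl⟩, -⟩ := h
    exact (hlab _).1 k v rfl
  have hcross : ∀ i x y, i ≠ Sum.inl i₀ →
      (lab.labelGraph i).Adj x y →
      (x ∈ Set.range e ↔ y ∉ Set.range e) := by
    intro i x y hi h
    rw [SimpleGraph.EdgeLabeling.labelGraph, SimpleGraph.fromEdgeSet_adj] at h
    obtain ⟨⟨h, rfl⟩, -⟩ := h
    by_contra hn
    refine hi ((hlab ⟨_, h⟩).2 ?_)
    rintro ⟨k, v, hkv⟩
    rcases Sym2.eq_iff.mp hkv with ⟨rfl, rfl⟩ | ⟨rfl, rfl⟩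
    · exact hn ⟨fun _ => v.2, fun _ => ⟨k, rfl⟩⟩
    · exact hn ⟨fun h => absurd h v.2, fun h => absurd ⟨k, rfl⟩ h⟩
  have hle : ∀ i, lab.labelGraph i ≤ G := by
    intro i x y h
    rw [SimpleGraph.EdgeLabeling.labelGraph, SimpleGraph.fromEdgeSet_adj] at h
    exact h.1.1
  obtain ⟨i | j, ⟨ι⟩⟩ := hG lab
  · left
    have hrange : ∀ x, ∃ k, e k = ι (Sum.inl x) := by
      intro x
      obtain ⟨A, hA, hA0⟩ := Finset.exists_ne_zero_of_sum_ne_zero (hf i x)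
      refine hdeg i A hA0 _ (((F i).card_fiber_le_ncard_neighborSet ι
        (by simpa using hA)).trans ?_)
      exact Set.ncard_le_ncard (fun y hy => hle _ hy) (Set.toFinite _)
    choose h hh using hrange
    have hinj : Function.Injective h := fun x x' hxx => by
      have := (hh x).symm.trans ((congrArg e hxx).trans (hh x'))
      exact Sum.inl.inj (ι.injective this)
    refine ⟨i, (F i).inWeight_of_map ht (hcard i) e ⟨h, hinj⟩ (fun y => ι (Sum.inr y))
      (fun y y' hyy => Sum.inr.inj (ι.injective hyy)) (fun v => (φ v).1 (Sum.inl i))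
      (hcount (Sum.inl i)) fun x y hy hxy => ?_⟩
    apply hmem
    simp only [Function.Embedding.coeFn_mk, hh]
    exact ι.toHom.map_rel (a := Sum.inl x) (b := Sum.inr y) (Or.inl ⟨x, y, rfl, rfl, hxy⟩)
  · right
    let P : Set (H j).V := {x | ι x ∈ Set.range e}
    have hP : ∀ x : P, ∃ k, e k = ι x.1 := fun x => x.2
    choose h hh using hP
    have hinj : Function.Injective h := fun x x' hxx => by
      have := (hh x).symm.trans ((congrArg e hxx).trans (hh x'))
      exact Subtype.ext (ι.injective this)
    refine ⟨j, P, fun x y hxy => hcross (Sum.inr j) _ _ (by simp) (ι.toHom.map_rel hxy),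
      ⟨h, hinj⟩, ?_⟩
    rintro A ⟨y, hy, hA⟩
    refine ⟨(φ ⟨ι y, hy⟩).1 (Sum.inr j), ?_, ?_⟩
    · intro k hk
      obtain ⟨x, hx, rfl⟩ := Finset.mem_map.mp hk
      apply hmem
      simp only [Function.Embedding.coeFn_mk, hh]
      exact ι.toHom.map_rel (hA x hx).symm
    · have h1 := hcount (Sum.inr j) ((φ ⟨ι y, hy⟩).1 (Sum.inr j))
      have h2 : 0 < (Finset.univ.filter fun v => (φ v).1 (Sum.inr j) =
          (φ ⟨ι y, hy⟩).1 (Sum.inr j)).card := Finset.card_pos.mpr ⟨⟨ι y, hy⟩, by simp⟩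
      have h3 : (0 : ℝ) < t * (c.subweight (Sum.inr j)).val ((φ ⟨ι y, hy⟩).1 (Sum.inr j)) :=
        lt_of_lt_of_le (by exact_mod_cast h2) h1
      exact pos_of_mul_pos_right h3 ht.le

/-! ### Existence of an arrowing weight -/

open Classical in
/-- By pigeonhole, some tuple of colour sets with union `B` carries a large part of `g_B`. -/
lemma Colouring.exists_lt_subweight {κ : Type w} [Fintype κ] {U : Type v} [Fintype U]
    {g : Weight U} (c : Colouring κ g) {b : ℝ} (hb : 0 ≤ b) {B : Finset U}
    (hB : Nat.card (DisjointTuple κ U) * b ≤ g.val B) :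
    ∃ A : DisjointTuple κ U, Finset.univ.biUnion A.1 = B ∧
      ∀ i, b < (c.subweight i).val (A.1 i) := by
  have h2 : ∃ A : DisjointTuple κ U, Finset.univ.biUnion A.1 = B ∧ b < c.val A := by
    by_contra! hcon
    refine absurd (c.lt_sum B) (not_lt.mpr (le_trans ?_ hB))
    refine (Finset.sum_le_card_nsmul _ _ b fun A hA => hcon A (Finset.mem_filter.mp hA).2).trans ?_
    rw [nsmul_eq_mul, Nat.card_eq_fintype_card]
    refine mul_le_mul_of_nonneg_right ?_ hb
    exact_mod_cast Finset.card_le_univ _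
  obtain ⟨A, hA, hbA⟩ := h2
  refine ⟨A, hA, fun i => hbA.trans_le ?_⟩
  simp only [Colouring.subweight]
  exact Finset.single_le_sum (f := fun A => c.val A) (fun A _ => c.nonneg A)
    (Finset.mem_filter.mpr ⟨Finset.mem_univ A, rfl⟩)

open Classical in
/-- A large weight concentrated on the whole of a large set arrows the tuple: by pigeonhole some
tuple of colour sets carries a large part of it, and one of its sets is large. -/
lemma exists_weightArrows {q s : ℕ} (hq : 1 ≤ q) {V : Fin q → Type u} [∀ i, Fintype (V i)]
    (f : ∀ i, Weight (V i)) (H : Fin s → FinGraph.{u}) (hH : ∀ j, (H j).graph.IsBipartite) :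
    ∃ (m : ℕ) (g : Weight (Fin m)), WeightArrows g f H := by
  let a : ℕ := ∑ i, Fintype.card (V i) + ∑ j, Fintype.card (H j).V
  let m : ℕ := (q + s) * a
  let b : ℝ := ∑ i, ∑ A, (f i).val A
  have hb : 0 ≤ b := Finset.sum_nonneg fun i _ => Finset.sum_nonneg fun A _ => (f i).nonneg A
  let T : ℝ := Nat.card (DisjointTuple (Fin q ⊕ Fin s) (Fin m)) * b
  have hT : 0 ≤ T := by positivity
  refine ⟨m, ⟨fun B => if B = Finset.univ then T else 0, fun B => by split_ifs <;> simp [hT]⟩,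
    fun c => ?_⟩
  obtain ⟨A, hA, hsub⟩ := c.exists_lt_subweight hb (B := Finset.univ) (by simp [T])
  have h3 : ∃ i, a ≤ (A.1 i).card := by
    by_contra! hcon
    have h4 : m ≤ ∑ i, (A.1 i).card := by
      have := Finset.card_biUnion_le (s := Finset.univ) (t := A.1)
      have hA' : (Finset.univ.biUnion A.1).card = m := by
        refine Eq.trans ?_ (Finset.card_fin m)
        convert congrArg Finset.card hA
      rwa [hA'] at this
    have h5 : ∑ i, (A.1 i).card < ∑ _i : Fin q ⊕ Fin s, a :=
      Finset.sum_lt_sum_of_nonempty ⟨Sum.inl ⟨0, hq⟩, Finset.mem_univ _⟩ fun i _ => hcon i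
    simp only [Finset.sum_const, Finset.card_univ, Fintype.card_sum, Fintype.card_fin,
      smul_eq_mul] at h5
    exact absurd h5 (not_lt.mpr h4)
  obtain ⟨i | j, hi⟩ := h3
  · left
    have hcard : Fintype.card (V i) ≤ Fintype.card (A.1 (Sum.inl i)) := by
      rw [Fintype.card_coe]
      refine le_trans ?_ hi
      exact (Finset.single_le_sum (f := fun i => Fintype.card (V i)) (fun _ _ => Nat.zero_le _)
        (Finset.mem_univ i)).trans (Nat.le_add_right _ _)
    obtain ⟨h⟩ := Function.Embedding.nonempty_of_card_le hcard
    refine ⟨i, Weight.inWeight_of_embedding (h.trans (Function.Embedding.subtype _))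
      (fun A' B => if B = A.1 (Sum.inl i) then (f i).val A' else 0) ?_ ?_ ?_ ?_⟩
    · intro A' B
      split_ifs
      · exact (f i).nonneg _
      · exact le_rfl
    · intro A' B hB
      rw [if_neg]
      rintro rfl
      apply hB
      intro k hk
      obtain ⟨x, -, rfl⟩ := Finset.mem_map.mp hk
      exact (h x).2
    · intro A'
      simp
    · intro B
      split_ifs with hB
      · subst hB
        refine le_trans ?_ (hsub _).le
        exact Finset.single_le_sum (f := fun i => ∑ A, (f i).val A)
          (fun i _ => Finset.sum_nonneg fun A _ => (f i).nonneg A) (Finset.mem_univ i)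
      · rw [Finset.sum_const_zero]
        exact (c.subweight _).nonneg B
  · right
    obtain ⟨col⟩ := hH j
    let P : Set (H j).V := {x | col x = 0}
    have hcard : Fintype.card P ≤ Fintype.card (A.1 (Sum.inr j)) := by
      rw [Fintype.card_coe]
      refine le_trans (Fintype.card_subtype_le _) (le_trans ?_ hi)
      exact (Finset.single_le_sum (f := fun j => Fintype.card (H j).V) (fun _ _ => Nat.zero_le _)
        (Finset.mem_univ j)).trans (Nat.le_add_left _ _)
    obtain ⟨h⟩ := Function.Embedding.nonempty_of_card_le hcard
    refine ⟨j, P, ?_, h.trans (Function.Embedding.subtype _), fun A' _ =>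
      ⟨A.1 (Sum.inr j), ?_, hb.trans_lt (hsub _)⟩⟩
    · intro x y hxy
      have := col.valid hxy
      simp only [P, Set.mem_ofPred_eq]
      omega
    · intro k hk
      obtain ⟨x, -, rfl⟩ := Finset.mem_map.mp hk
      exact (h x).2

/-! ### Deviations of a dilatation -/

lemma maxDeviation_nonneg {q : ℕ} {V : Fin q → Type u} {f : ∀ i, Weight (V i)}
    (F : ∀ i, BipGraph (V i)) (n : ℕ) : 0 ≤ maxDeviation f F n :=
  Real.iSup_nonneg fun _ => Real.iSup_nonneg fun _ => abs_nonneg _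

section

variable {q : ℕ} {V : Fin q → Type u} [∀ i, Fintype (V i)] {f : ∀ i, Weight (V i)}

lemma abs_sub_le_maxDeviation (F : ∀ i, BipGraph (V i)) (n : ℕ) (i : Fin q)
    (A : Finset (V i)) :
    |(((F i).fiber A).card : ℝ) - (f i).val A * n| ≤ maxDeviation f F n := by
  refine (le_ciSup (f := fun A => |(((F i).fiber A).card : ℝ) - (f i).val A * n|)
    (Set.finite_range _).bddAbove A).trans ?_
  exact le_ciSup (f := fun i => ⨆ A, |(((F i).fiber A).card : ℝ) - (f i).val A * n|)
    (Set.finite_range _).bddAbove i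

lemma eventually_maxDeviation_lt {F : ∀ i, ℕ → BipGraph (V i)}
    (hF : ∀ i, IsDilatation (f i) (F i)) (a b : ℝ) {η : ℝ} (hη : 0 < η) :
    ∀ᶠ n : ℕ in atTop, a * maxDeviation f (fun i => F i n) n + b < η * n := by
  have hδ : 0 < η / (2 * (|a| + 1)) := by positivity
  have h1 : ∀ᶠ n : ℕ in atTop, ∀ i A,
      |(((F i n).fiber A).card : ℝ) - (f i).val A * n| ≤ η / (2 * (|a| + 1)) * n := by
    refine eventually_all.mpr fun i => eventually_all.mpr fun A => ?_
    filter_upwards [((hF i).2 A).bound hδ] with n hn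
    simpa using hn
  have h2 : ∀ᶠ n : ℕ in atTop, 2 * b / η < n :=
    tendsto_natCast_atTop_atTop.eventually_gt_atTop _
  filter_upwards [h1, h2] with n hn hb
  have h3 : maxDeviation f (fun i => F i n) n ≤ η / (2 * (|a| + 1)) * n :=
    Real.iSup_le (fun i => Real.iSup_le (fun A => hn i A) (by positivity)) (by positivity)
  have h4 : a * maxDeviation f (fun i => F i n) n ≤ η / 2 * n := by
    have h5 := maxDeviation_nonneg (f := f) (fun i => F i n) n
    calc a * maxDeviation f (fun i => F i n) n
        ≤ (|a| + 1) * maxDeviation f (fun i => F i n) n :=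
          mul_le_mul_of_nonneg_right (by linarith [le_abs_self a]) h5
      _ ≤ (|a| + 1) * (η / (2 * (|a| + 1)) * n) :=
          mul_le_mul_of_nonneg_left h3 (by positivity)
      _ = η / 2 * n := by field_simp
  rw [div_lt_iff₀ hη] at hb
  linarith

end

/-- With such a `K`, a deviation `d` of the fibres over the support of `f` is made up for by a
change of the scale `n` by `K d`. -/
lemma exists_one_le_mul {q : ℕ} {V : Fin q → Type u} [∀ i, Fintype (V i)]
    (f : ∀ i, Weight (V i)) :
    ∃ K : ℝ, 0 < K ∧ ∀ i A, (f i).val A ≠ 0 → 1 ≤ (f i).val A * K := by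
  have hnn : ∀ i, 0 ≤ ∑ A, ((f i).val A)⁻¹ := fun i =>
    Finset.sum_nonneg fun A _ => inv_nonneg.mpr ((f i).nonneg A)
  refine ⟨∑ i, ∑ A, ((f i).val A)⁻¹ + 1,
    add_pos_of_nonneg_of_pos (Finset.sum_nonneg fun i _ => hnn i) one_pos, fun i A hA => ?_⟩
  have hpos : 0 < (f i).val A := lt_of_le_of_ne ((f i).nonneg A) (Ne.symm hA)
  have h1 : ((f i).val A)⁻¹ ≤ ∑ i, ∑ A, ((f i).val A)⁻¹ + 1 := by
    have h2 := Finset.single_le_sum (f := fun A => ((f i).val A)⁻¹)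
      (fun A _ => inv_nonneg.mpr ((f i).nonneg A)) (Finset.mem_univ A)
    have h3 := Finset.single_le_sum (f := fun i => ∑ A, ((f i).val A)⁻¹)
      (fun i _ => hnn i) (Finset.mem_univ i)
    linarith
  calc (1 : ℝ) = (f i).val A * ((f i).val A)⁻¹ := (mul_inv_cancel₀ hA).symm
    _ ≤ _ := mul_le_mul_of_nonneg_left h1 hpos.le

/-! ### Canonical dilatations -/

/-- The bipartite graph with `⌈f_A (n + 1)⌉` vertices of neighbourhood `A` for each `A`. The shift
makes the fibres over the support of `f` non-empty also for `n = 0`. -/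
noncomputable def Weight.blowUp {V : Type u} (f : Weight V) [Fintype V] (n : ℕ) : BipGraph V where
  V₂ := Σ A : Finset V, Fin ⌈f.val A * (n + 1)⌉₊
  Adj x y := x ∈ y.1

open Classical in
lemma Weight.card_fiber_blowUp {V : Type u} [Fintype V] (f : Weight V) (n : ℕ) (A : Finset V) :
    ((f.blowUp n).fiber A).card = ⌈f.val A * (n + 1)⌉₊ := by
  rw [← card_filter_sigma_fst_eq (fun A => ⌈f.val A * (n + 1)⌉₊) A]
  refine Finset.card_bij (fun y _ => y) (fun y hy => ?_) (fun _ _ _ _ h => h)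
    (fun y hy => ⟨y, ?_, rfl⟩)
  · exact Finset.mem_filter.mpr
      ⟨Finset.mem_univ _, (Finset.ext ((BipGraph.mem_fiber _).mp hy)).symm⟩
  · exact (BipGraph.mem_fiber _).mpr (Finset.ext_iff.mp (Finset.mem_filter.mp hy).2.symm)

lemma Weight.isDilatation_blowUp {V : Type u} [Fintype V] (f : Weight V) :
    IsDilatation f f.blowUp := by
  constructor
  · intro n A
    rw [← Finset.card_eq_zero, f.card_fiber_blowUp, Nat.ceil_eq_zero]
    have h1 : (0 : ℝ) < n + 1 := by positivity
    constructor
    · intro h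
      exact le_antisymm (nonpos_of_mul_nonpos_left h h1) (f.nonneg A)
    · intro h
      simp [h]
  · intro A
    have h1 : (fun n : ℕ => ((((f.blowUp n).fiber A).card : ℝ) - f.val A * n)) =O[atTop]
        fun _ => (1 : ℝ) := by
      refine IsBigO.of_bound (f.val A + 1) (Eventually.of_forall fun n => ?_)
      rw [f.card_fiber_blowUp, norm_one, mul_one, Real.norm_eq_abs, abs_le]
      have h2 := Nat.le_ceil (f.val A * (n + 1))
      have h3 := Nat.ceil_lt_add_one (a := f.val A * (n + 1))
        (mul_nonneg (f.nonneg A) (by positivity))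
      have h4 := f.nonneg A
      constructor <;> linarith
    exact h1.trans_isLittleO (isLittleO_const_left.mpr (Or.inr (by
      simpa using tendsto_norm_atTop_atTop.comp tendsto_natCast_atTop_atTop)))

/-! ### Comparison of the two Ramsey numbers -/

lemma Weight.size_nonneg {V : Type u} [Fintype V] (g : Weight V) : 0 ≤ g.size :=
  Finset.sum_nonneg fun A _ => mul_nonneg (g.nonneg A) (Nat.cast_nonneg _)

lemma sizeRamsey_le {κ : Type w} {F : κ → FinGraph.{u}} {N : ℕ} {G : SimpleGraph (Fin N)}
    (hG : GraphArrows G F) : sizeRamsey F ≤ G.edgeSet.ncard :=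
  Nat.sInf_le ⟨N, G, hG, rfl⟩

lemma exists_ncard_eq_sizeRamsey {κ : Type w} {F : κ → FinGraph.{u}}
    (h : ∃ (N : ℕ) (G : SimpleGraph (Fin N)), GraphArrows G F) :
    ∃ (N : ℕ) (G : SimpleGraph (Fin N)), GraphArrows G F ∧ G.edgeSet.ncard = sizeRamsey F := by
  obtain ⟨N, G, hG⟩ := h
  exact Nat.sInf_mem (s := {m : ℕ | ∃ (N : ℕ) (G : SimpleGraph (Fin N)),
    GraphArrows G F ∧ G.edgeSet.ncard = m}) ⟨_, N, G, hG, rfl⟩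

section

variable {q s : ℕ} {V : Fin q → Type u} [∀ i, Fintype (V i)] {f : ∀ i, Weight (V i)}
  {H : Fin s → FinGraph.{u}}

lemma weightRamsey_le {m : ℕ} {g : Weight (Fin m)} (hg : WeightArrows g f H) :
    weightRamsey f H ≤ g.size :=
  csInf_le ⟨0, by rintro _ ⟨m, g, -, rfl⟩; exact g.size_nonneg⟩ ⟨m, g, hg, rfl⟩

lemma weightRamsey_nonneg : 0 ≤ weightRamsey f H :=
  Real.sInf_nonneg (by rintro _ ⟨m, g, -, rfl⟩; exact g.size_nonneg)

/-- The upper bound, from the construction at the scale `n + K (d + O(1))`, where `d` is the largest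
deviation. The error term `E m` depends only on the number `m` of elements of the weight. -/
lemma exists_sizeRamsey_le (hf : ∀ i, (f i).NoIsolated) {K : ℝ} (hK : 0 < K)
    (hfK : ∀ i A, (f i).val A ≠ 0 → 1 ≤ (f i).val A * K) (H : Fin s → FinGraph.{u}) :
    ∃ E : ℕ → ℝ, (∀ m, 0 ≤ E m) ∧ ∀ (m : ℕ) (g : Weight (Fin m)), WeightArrows g f H →
      ∀ (F : ∀ i, BipGraph (V i)) (n : ℕ), (∀ i, (F i).Agrees (f i)) →
        (∃ (N : ℕ) (G : SimpleGraph (Fin N)), GraphArrows G (forbidden F H)) ∧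
        (sizeRamsey (forbidden F H) : ℝ) ≤
          (n + K * (maxDeviation f F n + E m)) * g.size + E m := by
  let C₀ : ℕ := ∑ j, Fintype.card (H j).V
  let D : ℕ → ℝ := fun m => ∑ B : Finset (Fin m),
    (1 + Nat.card (DisjointTuple (Fin q ⊕ Fin s) (Fin m)) * C₀ : ℝ) * B.card
  have hD : ∀ m, 0 ≤ D m := fun m => Finset.sum_nonneg fun B _ => by positivity
  refine ⟨fun m => Fintype.card (Finset (Fin m)) + D m, fun m => add_nonneg (by positivity) (hD m),
    fun m g hg F n hF => ?_⟩
  have hcard : 0 < (Fintype.card (Finset (Fin m)) : ℝ) := by exact_mod_cast Fintype.card_pos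
  have hdev := maxDeviation_nonneg (f := f) F n
  have ht : 0 < n + K * (maxDeviation f F n + Fintype.card (Finset (Fin m))) := by positivity
  obtain ⟨N, G, hG, hle⟩ := exists_graphArrows_ncard_le hf hg hF ht (fun i A hA => by
      have h1 := (abs_le.mp (abs_sub_le_maxDeviation (f := f) F n i A)).2
      have h2 := mul_le_mul_of_nonneg_right (hfK i A hA) (add_nonneg hdev hcard.le)
      linarith) (C₀ := C₀) (fun j => Finset.single_le_sum (f := fun j => Fintype.card (H j).V)
        (fun _ _ => Nat.zero_le _) (Finset.mem_univ j))
  refine ⟨⟨N, G, hG⟩, le_trans (Nat.cast_le.mpr (sizeRamsey_le hG)) (hle.trans ?_)⟩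
  have h3 := g.size_nonneg
  have h4 := hD m
  refine add_le_add (mul_le_mul_of_nonneg_right ?_ h3) (by simp only [D]; linarith)
  gcongr
  linarith

/-- The lower bound, for all large `n`. Since the size Ramsey number is linear in `n`, an optimal
graph has a bounded number of vertices of degree linear in `n`, and these are all that matters: the
weight has at most `m₀` elements. -/
lemma exists_weight_size_mul_le (hq : 1 ≤ q) (hf : ∀ i, (f i).NoIsolated) {K : ℝ} (hK : 0 < K)
    (hfK : ∀ i A, (f i).val A ≠ 0 → 1 ≤ (f i).val A * K)
    (hex : ∃ (m : ℕ) (g : Weight (Fin m)), WeightArrows g f H) :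
    ∃ (m₀ : ℕ) (E : ℝ), 0 ≤ E ∧ ∀ F : ∀ i, ℕ → BipGraph (V i),
      (∀ i, IsDilatation (f i) (F i)) → ∀ᶠ n : ℕ in atTop,
        0 < n - K * (maxDeviation f (fun i => F i n) n + E) ∧
        ∃ m ≤ m₀, ∃ g : Weight (Fin m), WeightArrows g f H ∧
          g.size * (n - K * (maxDeviation f (fun i => F i n) n + E)) ≤
            sizeRamsey (forbidden (fun i => F i n) H) + E := by
  classical
  obtain ⟨m₁, g₁, hg₁⟩ := hex
  obtain ⟨E₁, hE₁, hup⟩ := exists_sizeRamsey_le hf hK hfK H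
  let C : ℝ := 2 * g₁.size + 1
  have hg₁' := g₁.size_nonneg
  let m₀ : ℕ := ⌊4 * K * C⌋₊
  let D : ℕ → ℝ := fun m => ∑ B : Finset (Fin m),
    (Nat.card (DisjointTuple (Fin q ⊕ Fin s) (Fin m)) : ℝ) * B.card
  have hD : ∀ m, 0 ≤ D m := fun m => Finset.sum_nonneg fun B _ => by positivity
  let E : ℝ := m₀ + ∑ m ∈ Finset.range (m₀ + 1), D m
  have hE : 0 ≤ E := add_nonneg (Nat.cast_nonneg _) (Finset.sum_nonneg fun m _ => hD m)
  have hm₀E : (m₀ : ℝ) ≤ E := by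
    simp only [E]
    linarith [Finset.sum_nonneg fun m (_ : m ∈ Finset.range (m₀ + 1)) => hD m]
  have hDE : ∀ m ≤ m₀, D m ≤ E := fun m hm => by
    have := Finset.single_le_sum (fun m _ => hD m) (Finset.mem_range.mpr (Nat.lt_succ_of_le hm))
    simp only [E]
    linarith [Nat.cast_nonneg (α := ℝ) m₀]
  refine ⟨m₀, E, hE, fun F hF => ?_⟩
  -- The first condition makes the degrees in the copies exceed `n / (2K)`, the second makes the
  -- scale positive, and the third and fourth give `sizeRamsey ≤ C n`.
  filter_upwards [eventually_maxDeviation_lt hF 1 0 (η := 1 / (2 * K)) (by positivity),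
    eventually_maxDeviation_lt hF K (K * E) one_pos,
    eventually_maxDeviation_lt hF K (K * E₁ m₁) one_pos,
    eventually_maxDeviation_lt hF 0 (E₁ m₁) one_pos, eventually_gt_atTop 0] with n h1 h2 h3 h4 hn
  have hn' : (0 : ℝ) < n := by exact_mod_cast hn
  have hdev := maxDeviation_nonneg (f := f) (fun i => F i n) n
  obtain ⟨hexG, hle⟩ := hup m₁ g₁ hg₁ (fun i => F i n) n fun i => (hF i).1 n
  obtain ⟨N, G, hG, hGs⟩ := exists_ncard_eq_sizeRamsey hexG
  have hlin : (G.edgeSet.ncard : ℝ) ≤ C * n := by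
    rw [hGs]
    refine hle.trans ?_
    have : (n + K * (maxDeviation f (fun i => F i n) n + E₁ m₁)) * g₁.size ≤
        (2 * n) * g₁.size := mul_le_mul_of_nonneg_right (by linarith) hg₁'
    simp only [C]
    linarith
  have ht : 0 < n - K * (maxDeviation f (fun i => F i n) n + E) := by linarith
  refine ⟨ht, ?_⟩
  -- the vertices of large degree
  let L : Finset (Fin N) :=
    Finset.univ.filter fun v => 1 / (2 * K) * n ≤ ((G.neighborSet v).ncard : ℝ)
  have hL : L.card ≤ m₀ := by
    have hsum : ∑ v, (G.neighborSet v).ncard = 2 * G.edgeSet.ncard := by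
      rw [← SimpleGraph.coe_edgeFinset, Set.ncard_coe_finset,
        ← SimpleGraph.sum_degrees_eq_twice_card_edges]
      refine Finset.sum_congr rfl fun v _ => ?_
      rw [← SimpleGraph.card_neighborFinset_eq_degree, ← Set.ncard_coe_finset,
        SimpleGraph.coe_neighborFinset]
    have h5 : (L.card : ℝ) * (1 / (2 * K) * n) ≤ 2 * (C * n) := by
      rw [← nsmul_eq_mul]
      calc L.card • (1 / (2 * K) * n : ℝ)
          ≤ ∑ v ∈ L, ((G.neighborSet v).ncard : ℝ) :=
            Finset.card_nsmul_le_sum _ _ _ fun v hv => (Finset.mem_filter.mp hv).2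
        _ ≤ ∑ v, ((G.neighborSet v).ncard : ℝ) :=
            Finset.sum_le_univ_sum_of_nonneg fun v => Nat.cast_nonneg _
        _ = 2 * G.edgeSet.ncard := by exact_mod_cast hsum
        _ ≤ 2 * (C * n) := by linarith
    refine Nat.le_floor ?_
    have h6 : (L.card : ℝ) * (1 / (2 * K) * n) = L.card * n / (2 * K) := by ring
    rw [h6, div_le_iff₀ (by positivity)] at h5
    refine le_of_mul_le_mul_right ?_ hn'
    linarith
  let e : Fin L.card ↪ Fin N := (L.orderEmbOfFin rfl).toEmbedding
  have hrange : ∀ v, v ∈ L → v ∈ Set.range e := by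
    intro v hv
    have : Set.range (L.orderEmbOfFin rfl) = L := Finset.range_orderEmbOfFin L rfl
    change v ∈ Set.range (L.orderEmbOfFin rfl)
    rw [this]
    exact hv
  have hcard : ∀ i A, (f i).val A ≠ 0 →
      (f i).val A * n - maxDeviation f (fun i => F i n) n ≤ ((F i n).fiber A).card := by
    intro i A hA
    linarith [(abs_le.mp (abs_sub_le_maxDeviation (f := f) (fun i => F i n) n i A)).1]
  refine ⟨L.card, hL, neighbourWeight G e _ ht,
    weightArrows_neighbourWeight hf ⟨0, hq⟩ hG e ht ?_ ?_, ?_⟩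
  · intro i A hA
    have h5 := mul_le_mul_of_nonneg_right (hfK i A hA) (add_nonneg hdev hE)
    have h6 : (L.card : ℝ) ≤ m₀ := by exact_mod_cast hL
    have h7 := hcard i A hA
    rw [Fintype.card_fin]
    linarith
  · intro i A hA v hv
    apply hrange
    simp only [L, Finset.mem_filter, Finset.mem_univ, true_and]
    -- `f_A ≥ 1 / K`, and the deviation is at most half of that
    have h5 : 1 / K * n ≤ (f i).val A * n := by
      refine mul_le_mul_of_nonneg_right ?_ hn'.le
      rw [div_le_iff₀ hK]
      exact hfK i A hA
    have h6 : 1 / K * n = 1 / (2 * K) * n + 1 / (2 * K) * n := by field_simp; norm_num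
    have h7 : (((F i n).fiber A).card : ℝ) ≤ (G.neighborSet v).ncard := by exact_mod_cast hv
    linarith [hcard i A hA]
  · refine (neighbourWeight_size_mul_le G e _ ht).trans ?_
    rw [← hGs]
    gcongr
    exact hDE _ hL

/-- There are weights with a bounded number of elements, arrowing the tuple, whose size is
arbitrarily close to the infimum: pass from an almost optimal weight to a graph, which arrows a
canonical dilatation, and back. -/
lemma exists_bounded_weight (hq : 1 ≤ q) (hf : ∀ i, (f i).NoIsolated) {K : ℝ} (hK : 0 < K)
    (hfK : ∀ i A, (f i).val A ≠ 0 → 1 ≤ (f i).val A * K)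
    (hex : ∃ (m : ℕ) (g : Weight (Fin m)), WeightArrows g f H) :
    ∃ m₀ : ℕ, ∀ ε : ℝ, 0 < ε → ∃ m ≤ m₀, ∃ g : Weight (Fin m), WeightArrows g f H ∧
      g.size ≤ weightRamsey f H + ε := by
  obtain ⟨m₀, E, hE, hlow⟩ := exists_weight_size_mul_le hq hf hK hfK hex
  obtain ⟨E₁, hE₁, hup⟩ := exists_sizeRamsey_le hf hK hfK H
  refine ⟨m₀, fun ε hε => ?_⟩
  obtain ⟨m₂, g₂, hg₂⟩ := hex
  obtain ⟨_, ⟨m₁, g₁, hg₁, rfl⟩, hlt⟩ := exists_lt_of_csInf_lt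
    (s := {e : ℝ | ∃ (m : ℕ) (g : Weight (Fin m)), WeightArrows g f H ∧ g.size = e})
    ⟨_, m₂, g₂, hg₂, rfl⟩ (show weightRamsey f H < weightRamsey f H + ε / 2 by linarith)
  have hF : ∀ i, IsDilatation (f i) (f i).blowUp := fun i => (f i).isDilatation_blowUp
  obtain ⟨n, ⟨ht, m, hm, g, hg, hle⟩, hn⟩ := ((hlow _ hF).and (eventually_maxDeviation_lt hF
    ((g₁.size + ε / 2) * K + K * g₁.size)
    ((g₁.size + ε / 2) * K * E + K * E₁ m₁ * g₁.size + E₁ m₁ + E) (half_pos hε))).exists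
  refine ⟨m, hm, g, hg, ?_⟩
  by_contra! hcon
  have h1 := (hup m₁ g₁ hg₁ (fun i => (f i).blowUp n) n fun i => (hF i).1 n).2
  have h2 := mul_lt_mul_of_pos_right (show g₁.size + ε / 2 < g.size by linarith) ht
  linarith

/-- The infimum need not be attained for the upper bound: for each `n` a weight within `1 / n` of
it, on boundedly many elements, costs only `O(1)`. -/
lemma exists_sizeRamsey_bounds (hq : 1 ≤ q) (hf : ∀ i, (f i).NoIsolated)
    (hex : ∃ (m : ℕ) (g : Weight (Fin m)), WeightArrows g f H) :
    ∃ M : ℝ, ∀ F : ∀ i, ℕ → BipGraph (V i), (∀ i, IsDilatation (f i) (F i)) →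
      ∀ᶠ n : ℕ in atTop,
        weightRamsey f H * n - M * (1 + maxDeviation f (fun i => F i n) n) ≤
            (sizeRamsey (forbidden (fun i => F i n) H) : ℝ) ∧
          (sizeRamsey (forbidden (fun i => F i n) H) : ℝ) ≤
            weightRamsey f H * n + M * (1 + maxDeviation f (fun i => F i n) n) := by
  obtain ⟨K, hK, hfK⟩ := exists_one_le_mul f
  obtain ⟨m₂, E, hE, hlow⟩ := exists_weight_size_mul_le hq hf hK hfK hex
  obtain ⟨E₁, hE₁, hup⟩ := exists_sizeRamsey_le hf hK hfK H
  obtain ⟨m₀, hnear⟩ := exists_bounded_weight hq hf hK hfK hex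
  let E₂ : ℝ := ∑ m ∈ Finset.range (m₀ + 1), E₁ m
  have hE₂ : 0 ≤ E₂ := Finset.sum_nonneg fun m _ => hE₁ m
  have hR := weightRamsey_nonneg (f := f) (H := H)
  set R := weightRamsey f H with hRdef
  refine ⟨(K * (1 + E₂) * (R + 1) + 1 + E₂) + (R * K * (1 + E) + E), fun F hF => ?_⟩
  filter_upwards [hlow F hF, eventually_gt_atTop 0] with n hn hn0
  have hdev := maxDeviation_nonneg (f := f) (fun i => F i n) n
  set d := maxDeviation f (fun i => F i n) n
  have hd1 : d + E ≤ (1 + E) * (1 + d) := by nlinarith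
  have hd2 : d + E₂ ≤ (1 + E₂) * (1 + d) := by nlinarith
  have hn1 : (1 : ℝ) ≤ n := by exact_mod_cast hn0
  have hA : 0 ≤ (R * K * (1 + E) + E) * (1 + d) := by positivity
  have hB : 0 ≤ (K * (1 + E₂) * (R + 1) + 1 + E₂) * (1 + d) := by positivity
  rw [add_mul]
  constructor
  · obtain ⟨ht, m, -, g, hg, hle⟩ := hn
    have h1 := mul_le_mul_of_nonneg_right (weightRamsey_le hg) ht.le
    rw [← hRdef] at h1
    have h2 : R * K * (d + E) ≤ R * K * ((1 + E) * (1 + d)) :=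
      mul_le_mul_of_nonneg_left hd1 (by positivity)
    have h3 : E ≤ E * (1 + d) := le_mul_of_one_le_right hE (by linarith)
    linarith
  · obtain ⟨m, hm, g, hg, hle⟩ := hnear (1 / n) (by positivity)
    have h1 := (hup m g hg (fun i => F i n) n fun i => (hF i).1 n).2
    have hEm : E₁ m ≤ E₂ :=
      Finset.single_le_sum (fun m _ => hE₁ m) (Finset.mem_range.mpr (Nat.lt_succ_of_le hm))
    have h2 : (n + K * (d + E₁ m)) * g.size ≤ (n + K * (d + E₂)) * (R + 1 / n) :=
      mul_le_mul (by gcongr) hle g.size_nonneg (by positivity)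
    have h3 : (n + K * (d + E₂)) * (R + 1 / n) = R * n + 1 + K * (d + E₂) * (R + 1 / n) := by
      field_simp
    have h4 : K * (d + E₂) * (R + 1 / n) ≤ K * ((1 + E₂) * (1 + d)) * (R + 1) := by
      have : (1 : ℝ) / n ≤ 1 := by
        rw [div_le_one (by linarith)]
        exact hn1
      gcongr
    have h5 : 1 + E₂ ≤ (1 + E₂) * (1 + d) := le_mul_of_one_le_right (by linarith) (by linarith)
    linarith

end

end SizeRamsey

theorem mainTheorem1 (q s : ℕ) (hq : 1 ≤ q)
    (V : Fin q → Type u) [∀ i, Fintype (V i)] (f : ∀ i, Weight (V i))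
    (H : Fin s → FinGraph.{u})
    (hf : ∀ i, (f i).NoIsolated)
    (hH : ∀ j, (H j).graph.IsBipartite) (hH' : ∀ j, (H j).NoIsolated) :
    (∃ (m : ℕ) (g : Weight (Fin m)), WeightArrows g f H) ∧
    ∃ M : ℝ, ∀ F : ∀ i, ℕ → BipGraph (V i), (∀ i, IsDilatation (f i) (F i)) →
      (∀ n : ℕ, ∃ (N : ℕ) (G : SimpleGraph (Fin N)),
        GraphArrows G (forbidden (fun i => F i n) H)) ∧
      (∀ᶠ n : ℕ in atTop,
        weightRamsey f H * n - M * (1 + maxDeviation f (fun i => F i n) n) ≤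
            (sizeRamsey (forbidden (fun i => F i n) H) : ℝ) ∧
          (sizeRamsey (forbidden (fun i => F i n) H) : ℝ) ≤
            weightRamsey f H * n + M * (1 + maxDeviation f (fun i => F i n) n)) ∧
      Tendsto (fun n : ℕ => (sizeRamsey (forbidden (fun i => F i n) H) : ℝ) / n) atTop
        (𝓝 (weightRamsey f H)) := by
  have hex := exists_weightArrows hq f H hH
  refine ⟨hex, ?_⟩
  obtain ⟨M, hM⟩ := exists_sizeRamsey_bounds hq hf hex
  refine ⟨M, fun F hF => ⟨fun n => ?_, hM F hF, ?_⟩⟩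
  · obtain ⟨K, hK, hfK⟩ := exists_one_le_mul f
    obtain ⟨E, -, hup⟩ := exists_sizeRamsey_le hf hK hfK H
    obtain ⟨m, g, hg⟩ := hex
    exact (hup m g hg (fun i => F i n) n fun i => (hF i).1 n).1
  · rw [Metric.tendsto_nhds]
    intro ε hε
    filter_upwards [hM F hF, eventually_maxDeviation_lt hF M M hε, eventually_gt_atTop 0]
      with n ⟨h1, h2⟩ h3 hn
    have hn' : (0 : ℝ) < n := by exact_mod_cast hn
    rw [Real.dist_eq, div_sub' hn'.ne', abs_div, abs_of_pos hn', div_lt_iff₀ hn', abs_lt]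
    constructor <;> linarith
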